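/- Theorem. Let $BS(1,2)=\langle a,t \mid tat^{-1}=a^2\rangle$ and let $\Gamma$ be its Cayley graph with respect to $\{a,t\}$ (vertices are the group elements, and $g$ is joined to $ga$ and to $gt$). Give every edge of a graph length $1$ and the graph the resulting path metric. A cycle of length $n$ in a graph $\Lambda$ is a map $f\colon C\to\Lambda$, where $C$ is a circle subdivided into $n\ge 1$ edges of length $1$, which sends vertices to vertices and each edge isometrically onto an edge. The cycle $f$ is isometric if it is an isometric embedding, and $\xi$-almost isometric, for $\xi\in(0,1)$, if $d_\Lambda(f(p),f(q))\ge \xi\, n/2$ for every pair of antipodal points $p,q\in C$. A connected simplicial graph is shortcut if there is a bound on the lengths of its isometric cycles, and strongly shortcut if, for some $\xi\in(0,1)$, there is a bound on the lengths of its $\xi$-almost isometric cycles. A group is shortcut (respectively strongly shortcut) if it acts properly and cocompactly by graph automorphisms on a shortcut (respectively strongly shortcut) graph. Then: (1) every isometric cycle in $\Gamma$ has length at most $5$; in particular $\Gamma$ is shortcut; (2) the group $BS(1,2)$ is shortcut but not strongly shortcut. -/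

import Mathlib

universe u

namespace ShortcutGraph

/-- A point of the geometric realization of the simplicial graph `Γ` (every edge is a copy of
`[0,1]`): the point at distance `pos` from `src` on the edge from `src` to `tgt`. A vertex is given
by `pos = 0` or `pos = 1`; several triples may represent the same point. -/
structure EdgePoint {V : Type u} (Γ : SimpleGraph V) where
  src : V
  tgt : V
  adj : Γ.Adj src tgt
  pos : ℝ
  pos_mem : pos ∈ Set.Icc (0 : ℝ) 1

/-- Length of a shortest path between two points of the realization that passes through at least
one endpoint of each of their edges. -/
noncomputable def EdgePoint.distVia {V : Type u} {Γ : SimpleGraph V} (p q : EdgePoint Γ) : ℝ :=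
  min
    (min (p.pos + (Γ.dist p.src q.src : ℝ) + q.pos)
      (p.pos + (Γ.dist p.src q.tgt : ℝ) + (1 - q.pos)))
    (min ((1 - p.pos) + (Γ.dist p.tgt q.src : ℝ) + q.pos)
      ((1 - p.pos) + (Γ.dist p.tgt q.tgt : ℝ) + (1 - q.pos)))

open Classical in
/-- The geodesic distance between two points of (a connected component of) the realization. Two
points on the same edge are joined by the segment of that edge between them. -/
noncomputable def EdgePoint.dist {V : Type u} {Γ : SimpleGraph V} (p q : EdgePoint Γ) : ℝ :=
  if p.src = q.src ∧ p.tgt = q.tgt then |p.pos - q.pos|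
  else if p.src = q.tgt ∧ p.tgt = q.src then |p.pos - (1 - q.pos)|
  else p.distVia q

/-- A cycle of length `n` in `Γ`: a nondegenerate combinatorial map to `Γ` from the circle
subdivided into `n` edges, given by the images of the consecutive vertices. It need not be
injective. -/
structure CycleIn {V : Type u} (Γ : SimpleGraph V) (n : ℕ) where
  vert : ZMod n → V
  length_pos : 0 < n
  adj : ∀ i, Γ.Adj (vert i) (vert (i + 1))

/-- The image under a cycle of the point with arc-length parameter `x` (modulo `n`). -/
noncomputable def CycleIn.point {V : Type u} {Γ : SimpleGraph V} {n : ℕ} (f : CycleIn Γ n)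
    (x : ℝ) : EdgePoint Γ where
  src := f.vert ((⌊x⌋ : ℤ) : ZMod n)
  tgt := f.vert (((⌊x⌋ : ℤ) : ZMod n) + 1)
  adj := f.adj _
  pos := Int.fract x
  pos_mem := ⟨Int.fract_nonneg x, (Int.fract_lt_one x).le⟩

/-- A cycle is isometric if it is an isometric embedding of the circle of circumference `n`
(`AddCircle n`, with its arc-length distance) in the realization of `Γ`. -/
def CycleIn.IsIsometric {V : Type u} {Γ : SimpleGraph V} {n : ℕ} (f : CycleIn Γ n) : Prop :=
  ∀ x y : ℝ, (f.point x).dist (f.point y) = ‖((x - y : ℝ) : AddCircle (n : ℝ))‖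

/-- A cycle of length `n` is `ξ`-almost isometric if the images of any two antipodal points are at
distance at least `ξ * n / 2`. -/
def CycleIn.IsAlmostIsometric {V : Type u} {Γ : SimpleGraph V} {n : ℕ} (f : CycleIn Γ n)
    (ξ : ℝ) : Prop :=
  ∀ x : ℝ, ξ * ((n : ℝ) / 2) ≤ (f.point x).dist (f.point (x + (n : ℝ) / 2))

/-- A connected simplicial graph is shortcut if the lengths of its isometric cycles are bounded. -/
def IsShortcut {V : Type u} (Γ : SimpleGraph V) : Prop :=
  Γ.Connected ∧ ∃ θ : ℕ, ∀ (n : ℕ) (f : CycleIn Γ n), f.IsIsometric → n ≤ θ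

/-- A connected simplicial graph is strongly shortcut if, for some `ξ ∈ (0,1)`, the lengths of its
`ξ`-almost isometric cycles are bounded. -/
def IsStronglyShortcut {V : Type u} (Γ : SimpleGraph V) : Prop :=
  Γ.Connected ∧ ∃ θ : ℕ, ∃ ξ : ℝ, 0 < ξ ∧ ξ < 1 ∧
    ∀ (n : ℕ) (f : CycleIn Γ n), f.IsAlmostIsometric ξ → n ≤ θ

/-- The given action of `G` on the vertices is a proper and cocompact action on the graph `Γ` by
graph automorphisms. -/
structure IsGeometricAction (G : Type u) [Group G] {V : Type u} [MulAction G V]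
    (Γ : SimpleGraph V) : Prop where
  /-- `G` acts by graph automorphisms. -/
  adj_smul : ∀ (g : G) (v w : V), Γ.Adj v w → Γ.Adj (g • v) (g • w)
  /-- The action is proper: only finitely many elements move a finite set of vertices to a set
  that meets it (equivalently, cell stabilizers are finite). -/
  proper : ∀ S : Finset V, {g : G | ∃ v ∈ S, g • v ∈ S}.Finite
  /-- The action is cocompact: the translates of the subgraph induced on some finite set of
  vertices cover all vertices and all edges. -/
  cocompact : ∃ S : Finset V, (∀ v, ∃ g : G, g • v ∈ S) ∧
    ∀ v w, Γ.Adj v w → ∃ g : G, g • v ∈ S ∧ g • w ∈ S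

/-- A group is shortcut if it acts properly and cocompactly on a shortcut graph. (By cocompactness
the vertex set is a finite union of orbits, so nothing is lost by taking it in the universe
of `G`.) -/
def IsShortcutGroup (G : Type u) [Group G] : Prop :=
  ∃ (V : Type u) (Γ : SimpleGraph V) (_ : MulAction G V), IsShortcut Γ ∧ IsGeometricAction G Γ

/-- A group is strongly shortcut if it acts properly and cocompactly on a strongly shortcut
graph. -/
def IsStronglyShortcutGroup (G : Type u) [Group G] : Prop :=
  ∃ (V : Type u) (Γ : SimpleGraph V) (_ : MulAction G V),
    IsStronglyShortcut Γ ∧ IsGeometricAction G Γ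

/-- The two generators of the Baumslag-Solitar group. -/
inductive BSGen : Type
  | a
  | t

/-- The relator of `t a t⁻¹ = a²`. -/
def bsRels : Set (FreeGroup BSGen) :=
  {FreeGroup.of BSGen.t * FreeGroup.of BSGen.a * (FreeGroup.of BSGen.t)⁻¹ *
    (FreeGroup.of BSGen.a ^ 2)⁻¹}

/-- The Baumslag-Solitar group `BS(1,2) = ⟨a, t | t a t⁻¹ = a²⟩`. -/
abbrev BS12 : Type := PresentedGroup bsRels

/-- The standard Cayley graph of `BS(1,2)`: vertices are the group elements, and `g` is joined to
`g * a` and to `g * t`. -/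
def bsCayley : SimpleGraph BS12 :=
  SimpleGraph.mulCayley
    ({PresentedGroup.of BSGen.a, PresentedGroup.of BSGen.t} : Set BS12)

end ShortcutGraph

/-! An element of BS(1,2) is determined by its `t`-exponent sum (its height) and by the image of 0
under the affine action `a x = x + 1`, `t x = 2 x`. Words of height 0 act as translations, so they
commute.

Isometric cycles. The label of such a cycle is a trivial word all of whose cyclic subwords of at
most half its length are geodesic. Rotated to start at its lowest height, it is a product of letters
`a^{±1}` and excursions `t M t⁻¹`. If it has length at least 6, shortenings such as `a² t = t a`
leave exactly one letter between consecutive excursions. A single excursion is excluded by parity.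
Among three or more, two subwords `a^{±1} t M t⁻¹ a^{±1}` share only one letter, so one of them has
at most half the length, yet it is not geodesic. Two excursions are excluded by a descent
(`CyclicallyGeodesic.not_isRotated_excursions`): both are peeled one level at a time, their
translations keeping a sum in [-1, 1], until one is a power of `a`; then letters `a^{±1}` of
opposite sign allow a shortening along one of the two arcs.

No strong shortcut property. In a strongly shortcut graph every long closed walk splits into two
closed walks shorter by a fixed factor, so a function of walks that is additive under splitting and
bounded on short closed walks grows at most polynomially with length
(`IsStronglyShortcut.exists_walkFlux_le`). The flux, which measures horizontal displacement over one
half-space of the Bass-Serre tree, is such a function. On the commutator of `tⁿ a t⁻ⁿ` and `t⁻¹ a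
t`, of length linear in `n`, it equals `2 * 2 ^ n`. Since BS(1,2) is torsion-free, its proper
actions are free, and the flux pulls back to any graph with a geometric action. -/

namespace ShortcutGraph

open List

/-! ### Words, heights and translations -/

/-- The letters of words in the generators of `BS(1,2)`: `a^{±1}`, `t` and `t⁻¹`. -/
inductive Letter : Type
  | a (s : ℤˣ)
  | t
  | tInv

namespace Letter

/-- The `t`-exponent sum of a word. -/
def height : List Letter → ℤ
  | [] => 0
  | a _ :: w => height w
  | t :: w => height w + 1
  | tInv :: w => height w - 1

/-- The image of `0` under the affine action with `a x = x + 1` and `t x = 2 x`. -/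
def transl : List Letter → ℚ
  | [] => 0
  | a s :: w => ((s : ℤ) : ℚ) + transl w
  | t :: w => 2 * transl w
  | tInv :: w => transl w / 2

@[simp] theorem height_nil : height [] = 0 := rfl
@[simp] theorem height_a (s w) : height (a s :: w) = height w := rfl
@[simp] theorem height_t (w) : height (t :: w) = height w + 1 := rfl
@[simp] theorem height_tInv (w) : height (tInv :: w) = height w - 1 := rfl
@[simp] theorem transl_nil : transl [] = 0 := rfl
@[simp] theorem transl_a (s w) : transl (a s :: w) = ((s : ℤ) : ℚ) + transl w := rfl
@[simp] theorem transl_t (w) : transl (t :: w) = 2 * transl w := rfl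
@[simp] theorem transl_tInv (w) : transl (tInv :: w) = transl w / 2 := rfl

@[simp] theorem height_append (u v : List Letter) : height (u ++ v) = height u + height v := by
  induction u with
  | nil => simp
  | cons x u ih => cases x <;> simp [ih] <;> ring

@[simp] theorem transl_append (u v : List Letter) :
    transl (u ++ v) = transl u + 2 ^ height u * transl v := by
  induction u with
  | nil => simp
  | cons x u ih =>
    cases x <;> simp [ih, zpow_add₀, zpow_sub₀] <;> ring

@[simp] theorem height_map_a (S : List ℤˣ) : height (S.map a) = 0 := by
  induction S with
  | nil => simp
  | cons s S ih => simpa using ih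

@[simp] theorem transl_map_a (S : List ℤˣ) :
    transl (S.map a) = (((S.map (fun s : ℤˣ => (s : ℤ))).sum : ℤ) : ℚ) := by
  induction S with
  | nil => simp
  | cons s S ih => simp [ih]

theorem height_eq_of_isRotated {u v : List Letter} (h : u ~r v) : height u = height v := by
  have key : ∀ w : List Letter, height w = (w.map (fun x => height [x])).sum := by
    intro w
    induction w with
    | nil => simp
    | cons x w ih => cases x <;> simp [ih] <;> ring
  rw [key u, key v]
  exact (h.perm.map _).sum_eq

/-- A word is geodesic if no shorter word represents the same group element. -/
def Geodesic (u : List Letter) : Prop :=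
  ∀ u', transl u' = transl u → height u' = height u → u.length ≤ u'.length

theorem Geodesic.infix {p u q : List Letter} (h : Geodesic (p ++ (u ++ q))) : Geodesic u := by
  intro u' hX hH
  have := h (p ++ (u' ++ q)) (by simp [hX, hH]) (by simp [hH])
  simp at this
  omega

theorem Geodesic.left {u q : List Letter} (h : Geodesic (u ++ q)) : Geodesic u :=
  Geodesic.infix (p := []) (q := q) (by simpa using h)

theorem Geodesic.right {p u : List Letter} (h : Geodesic (p ++ u)) : Geodesic u :=
  Geodesic.infix (p := p) (q := []) (by simpa using h)

/-! ### Motzkin words and rotation to the lowest point -/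

/-- The words of height `0` all of whose prefixes have nonnegative height. -/
inductive Motzkin : List Letter → Prop
  | nil : Motzkin []
  | a (s w) : Motzkin w → Motzkin (Letter.a s :: w)
  | up (u v) : Motzkin u → Motzkin v → Motzkin (t :: (u ++ tInv :: v))

theorem Motzkin.height_eq {w : List Letter} (h : Motzkin w) : height w = 0 := by
  induction h with
  | nil => simp
  | a s w _ ih => simpa using ih
  | up u v _ _ ih1 ih2 => simp [ih1, ih2]

theorem Motzkin.append {u v : List Letter} (hu : Motzkin u) (hv : Motzkin v) :
    Motzkin (u ++ v) := by
  induction hu with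
  | nil => simpa using hv
  | a s w _ ih => exact .a s _ ih
  | up u w h1 _ _ ih2 => simpa using Motzkin.up u (w ++ v) h1 ih2

theorem Motzkin.map_a (S : List ℤˣ) : Motzkin (S.map Letter.a) := by
  induction S with
  | nil => exact .nil
  | cons s S ih => exact .a s _ ih

theorem Motzkin.exists_int {w : List Letter} (h : Motzkin w) : ∃ z : ℤ, transl w = z := by
  induction h with
  | nil => exact ⟨0, by simp⟩
  | a s w _ ih => obtain ⟨z, hz⟩ := ih; exact ⟨s + z, by simp [hz]⟩
  | up u v hu _ ih1 ih2 =>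
    obtain ⟨y, hy⟩ := ih1
    obtain ⟨z, hz⟩ := ih2
    refine ⟨2 * y + z, ?_⟩
    simp [hy, hz, hu.height_eq]
    ring

theorem Motzkin.parse {w : List Letter} (h : Motzkin w) :
    (∃ S : List ℤˣ, w = S.map Letter.a) ∨
    ∃ (S : List ℤˣ) (M q : List Letter), Motzkin M ∧ Motzkin q ∧
      w = S.map Letter.a ++ t :: (M ++ tInv :: q) := by
  induction h with
  | nil => exact .inl ⟨[], rfl⟩
  | a s w _ ih =>
    rcases ih with ⟨S, rfl⟩ | ⟨S, M, q, hM, hq, rfl⟩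
    · exact .inl ⟨s :: S, rfl⟩
    · exact .inr ⟨s :: S, M, q, hM, hq, rfl⟩
  | up u v hu hv _ _ => exact .inr ⟨[], u, v, hu, hv, rfl⟩

/-- Words of height `-k`, products of Motzkin words separated by `k` letters `t⁻¹`. -/
inductive Descent : ℕ → List Letter → Prop
  | zero (m) : Motzkin m → Descent 0 m
  | succ (k m w) : Motzkin m → Descent k w → Descent (k + 1) (m ++ tInv :: w)

/-- Words of height `k`, products of Motzkin words separated by `k` letters `t`. -/
inductive Ascent : ℕ → List Letter → Prop
  | zero (m) : Motzkin m → Ascent 0 m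
  | succ (k m w) : Motzkin m → Ascent k w → Ascent (k + 1) (m ++ t :: w)

theorem Descent.motzkin_append {k : ℕ} {m w : List Letter} (hm : Motzkin m) (h : Descent k w) :
    Descent k (m ++ w) := by
  cases h with
  | zero _ h => exact .zero _ (hm.append h)
  | succ k m' w h h' => rw [← List.append_assoc]; exact .succ k _ w (hm.append h) h'

theorem Descent.height_eq {k : ℕ} {w : List Letter} (h : Descent k w) : height w = -k := by
  induction h with
  | zero m h => simp [h.height_eq]
  | succ k m w h _ ih => simp [h.height_eq, ih]; ring

theorem Ascent.height_eq {k : ℕ} {w : List Letter} (h : Ascent k w) : height w = k := by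
  induction h with
  | zero m h => simp [h.height_eq]
  | succ k m w h _ ih => simp [h.height_eq, ih]

theorem Descent.exists_of_succ {k : ℕ} {w : List Letter} (h : Descent (k + 1) w) :
    ∃ m w', Motzkin m ∧ Descent k w' ∧ w = m ++ tInv :: w' := by
  cases h with
  | succ _ m w' hm hw => exact ⟨m, w', hm, hw, rfl⟩

/-- Each separating `t` of the ascent is matched with the next unmatched `t⁻¹` of the descent, which
closes an excursion. -/
theorem Ascent.append_descent {l : ℕ} {A : List Letter} (hA : Ascent l A) :
    ∀ {j : ℕ} {D : List Letter}, Descent (l + j) D → Descent j (A ++ D) := by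
  induction hA with
  | zero m h => intro j D hD; rw [Nat.zero_add] at hD; exact hD.motzkin_append h
  | succ k m w h _ ih =>
    intro j D hD
    have h1 := ih (j := j + 1) (D := D) (by convert hD using 1; ring)
    obtain ⟨m', w', hm', hw', he⟩ := h1.exists_of_succ
    have h2 := hw'.motzkin_append (h.append (.up m' [] hm' .nil))
    simpa [he] using h2

theorem exists_descent_ascent (w : List Letter) :
    ∃ k l D A, w = D ++ A ∧ Descent k D ∧ Ascent l A := by
  induction w with
  | nil => exact ⟨0, 0, [], [], rfl, .zero _ .nil, .zero _ .nil⟩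
  | cons x w ih =>
    obtain ⟨k, l, D, A, rfl, hD, hA⟩ := ih
    cases x with
    | a s => exact ⟨k, l, a s :: D, A, rfl, hD.motzkin_append (.a s _ .nil), hA⟩
    | tInv => exact ⟨k + 1, l, tInv :: D, A, rfl, .succ k [] D .nil hD, hA⟩
    | t =>
      -- A new leading `t` either lengthens the ascent, if there is no descent, or closes an
      -- excursion with the first separating `t⁻¹`.
      cases hD with
      | zero _ h =>
        refine ⟨0, l + 1, [], t :: (D ++ A), rfl, .zero _ .nil, .succ l [] _ .nil ?_⟩
        cases hA with
        | zero _ h' => exact .zero _ (h.append h')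
        | succ k m' w h' h'' => rw [← List.append_assoc]; exact .succ k _ w (h.append h') h''
      | succ k m w h h' =>
        refine ⟨k, l, t :: (m ++ tInv :: w), A, rfl, ?_, hA⟩
        simpa using h'.motzkin_append (.up m [] h .nil)

/-- Cutting at the end of the descent, where the height is minimal, and rotating there makes all
prefix heights nonnegative. -/
theorem exists_isRotated_motzkin {w : List Letter} (h : height w = 0) :
    ∃ w', w ~r w' ∧ Motzkin w' := by
  obtain ⟨k, l, D, A, rfl, hD, hA⟩ := exists_descent_ascent w
  refine ⟨A ++ D, isRotated_append, ?_⟩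
  simp [hD.height_eq, hA.height_eq] at h
  obtain rfl : k = l := by omega
  have := hA.append_descent (j := 0) hD
  cases this with
  | zero _ h => exact h

/-! ### Shortening rules and the shape of geodesic Motzkin words -/

theorem not_geodesic_of_shorter {u : List Letter} (u' : List Letter) (hX : transl u' = transl u)
    (hH : height u' = height u) (hl : u'.length < u.length) : ¬ Geodesic u :=
  fun h => by have := h u' hX hH; omega

theorem units_eq_or_eq_neg (s s' : ℤˣ) : s' = s ∨ s' = -s := by
  rcases Int.units_eq_one_or s with rfl | rfl <;> rcases Int.units_eq_one_or s' with rfl | rfl <;>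
    simp

theorem not_geodesic_cancel (s : ℤˣ) : ¬ Geodesic [a s, a (-s)] :=
  not_geodesic_of_shorter [] (by simp) (by simp) (by simp)

theorem not_geodesic_tInv_t : ¬ Geodesic [tInv, t] :=
  not_geodesic_of_shorter [] (by simp) (by simp) (by simp)

theorem not_geodesic_t_tInv : ¬ Geodesic [t, tInv] :=
  not_geodesic_of_shorter [] (by simp) (by simp) (by simp)

theorem not_geodesic_a_a_t (s s' : ℤˣ) : ¬ Geodesic [a s, a s', t] := by
  rcases units_eq_or_eq_neg s s' with rfl | rfl
  · exact not_geodesic_of_shorter [t, a s'] (by simp; ring) (by simp) (by simp)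
  · exact not_geodesic_of_shorter [t] (by simp) (by simp) (by simp)

/-- Consecutive excursions commute, so that a pair of letters `t⁻¹ t` can be cancelled. -/
theorem not_geodesic_two_excursions {M p M' : List Letter} (hM : height M = 0) (hp : height p = 0)
    (hM' : height M' = 0) :
    ¬ Geodesic (t :: (M ++ tInv :: (p ++ t :: (M' ++ [tInv])))) := by
  refine not_geodesic_of_shorter (p ++ t :: (M ++ M' ++ [tInv])) ?_ ?_ ?_
  · simp [hM, hp, hM']; ring
  · simp [hM, hp, hM']
  · simp; omega

/-- Letters `a^{±1}` on both sides of an excursion can be collected. -/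
theorem not_geodesic_sandwich {M : List Letter} (hM : height M = 0) (s s' : ℤˣ) :
    ¬ Geodesic (a s :: t :: (M ++ [tInv, a s'])) := by
  rcases units_eq_or_eq_neg s s' with rfl | rfl
  · exact not_geodesic_of_shorter (t :: a s' :: (M ++ [tInv])) (by simp [hM]; ring) (by simp [hM])
      (by simp)
  · exact not_geodesic_of_shorter (t :: (M ++ [tInv])) (by simp [hM]; ring) (by simp [hM])
      (by simp)

theorem Geodesic.exists_eq_replicate {S : List ℤˣ} (hS : Geodesic (S.map a)) :
    ∃ (k : ℕ) (s : ℤˣ), S = replicate k s := by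
  induction S with
  | nil => exact ⟨0, 1, rfl⟩
  | cons s S ih =>
    obtain ⟨k, s', rfl⟩ := ih (Geodesic.right (p := [a s]) hS)
    rcases k with - | k
    · exact ⟨1, s, rfl⟩
    · rcases units_eq_or_eq_neg s s' with rfl | rfl
      · exact ⟨k + 2, s', rfl⟩
      · exact absurd (Geodesic.left (u := [a s, a (-s)]) (by simpa [replicate_succ] using hS))
          (not_geodesic_cancel s)

theorem replicate_le_five {k : ℕ} {s : ℤˣ} (h : Geodesic ((replicate k s).map a)) : k ≤ 5 := by
  by_contra! hk
  obtain ⟨j, rfl⟩ := Nat.exists_eq_add_of_le hk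
  rw [replicate_add, map_append] at h
  refine not_geodesic_of_shorter [t, a s, a s, a s, tInv] ?_ ?_ ?_ h.left
  · simp [replicate]; ring
  · simp
  · simp

/-- Geodesic Motzkin words are powers of `a`, or an excursion with at most one letter `a^{±1}`
before or after it. -/
theorem Motzkin.geodesic_cases {w : List Letter} (h : Motzkin w) (hg : Geodesic w) :
    (∃ (k : ℕ) (s : ℤˣ), w = (replicate k s).map Letter.a) ∨
    ∃ (P Q : List ℤˣ) (M : List Letter), Motzkin M ∧ Geodesic (t :: (M ++ [tInv])) ∧
      P.length + Q.length ≤ 1 ∧ w = P.map Letter.a ++ t :: (M ++ tInv :: Q.map Letter.a) := by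
  rcases h.parse with ⟨S, rfl⟩ | ⟨P, M, q, hM, hq, rfl⟩
  · obtain ⟨k, s, rfl⟩ := Geodesic.exists_eq_replicate hg
    exact .inl ⟨k, s, rfl⟩
  rcases hq.parse with ⟨Q, rfl⟩ | ⟨S, M', q', hM', -, rfl⟩
  · refine .inr ⟨P, Q, M, hM, ?_, ?_, rfl⟩
    · exact Geodesic.infix (p := P.map Letter.a) (q := Q.map Letter.a) (by simpa using hg)
    -- The excursion is a translation, so any two letters outside it can be brought together: equal
    -- ones become a single letter inside it, opposite ones cancel.
    · by_contra! hl
      have h2 : 2 ≤ (P ++ Q).length := by simp; omega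
      obtain ⟨x, y, R, hR⟩ : ∃ x y R, P ++ Q = x :: y :: R := by
        match hPQ : P ++ Q with
        | x :: y :: R => exact ⟨x, y, R, rfl⟩
        | [x] => simp [hPQ] at h2
        | [] => simp [hPQ] at h2
      have hs : transl (P.map Letter.a) + transl (Q.map Letter.a) =
          ((x : ℤ) : ℚ) + (((y : ℤ) : ℚ) + transl (R.map Letter.a)) := by
        have := congrArg (fun L => transl (L.map Letter.a)) hR
        simpa [-transl_map_a] using this
      have hlen : P.length + Q.length = R.length + 2 := by
        have := congrArg List.length hR
        simpa using this
      rcases units_eq_or_eq_neg x y with rfl | rfl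
      · refine not_geodesic_of_shorter (R.map Letter.a ++ t :: Letter.a y :: (M ++ [tInv])) ?_ ?_ ?_ hg
        · simp [hM.height_eq, -transl_map_a]
          linear_combination -hs
        · simp [hM.height_eq]
        · simp; omega
      · refine not_geodesic_of_shorter (R.map Letter.a ++ t :: (M ++ [tInv])) ?_ ?_ ?_ hg
        · simp [hM.height_eq, -transl_map_a] at hs ⊢
          linear_combination -hs
        · simp [hM.height_eq]
        · simp; omega
  · refine absurd (Geodesic.infix (p := P.map Letter.a) (q := q') ?_) (not_geodesic_two_excursions
      hM.height_eq (height_map_a S) hM'.height_eq)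
    simpa using hg

/-- `t t⁻¹` is trivial and `t a t⁻¹ = a²` is shorter on the right. -/
theorem two_le_of_geodesic_excursion {k : ℕ} {s : ℤˣ}
    (h : Geodesic (t :: ((replicate k s).map a ++ [tInv]))) : 2 ≤ k := by
  by_contra! hk
  interval_cases k
  · exact not_geodesic_t_tInv (by simpa using h)
  · exact not_geodesic_of_shorter [a s, a s] (by simp [replicate]; ring) (by simp) (by simp) h

theorem Motzkin.two_le_length {M : List Letter} (hM : Motzkin M)
    (h : Geodesic (t :: (M ++ [tInv]))) : 2 ≤ M.length := by
  rcases hM.geodesic_cases (Geodesic.infix (p := [t]) (q := [tInv]) (by simpa using h)) with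
    ⟨k, s, rfl⟩ | ⟨P, Q, M, -, -, -, rfl⟩
  · simpa using two_le_of_geodesic_excursion h
  · simp; omega

/-! ### Cyclically geodesic words -/

/-- A word representing the identity all of whose cyclic subwords of at most half its length are
geodesic. -/
structure CyclicallyGeodesic (W : List Letter) : Prop where
  transl_eq : transl W = 0
  height_eq : height W = 0
  geodesic : ∀ u v, W ~r (u ++ v) → 2 * u.length ≤ W.length → Geodesic u

/-- Rotation is conjugation: the two pieces have opposite heights, so `x + 2 ^ h * y = 0` gives `y +
2 ^ (-h) * x = 0`. -/
theorem CyclicallyGeodesic.isRotated {W W' : List Letter} (h : CyclicallyGeodesic W)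
    (hr : W ~r W') : CyclicallyGeodesic W' where
  height_eq := by rw [← height_eq_of_isRotated hr, h.height_eq]
  transl_eq := by
    obtain ⟨n, rfl⟩ := hr
    obtain ⟨m, hm⟩ : ∃ m, W.rotate n = W.drop m ++ W.take m :=
      ⟨n % W.length, rotate_eq_drop_append_take_mod⟩
    have h1 := h.transl_eq
    have h2 := h.height_eq
    rw [← take_append_drop m W] at h1 h2
    rw [transl_append] at h1
    rw [height_append] at h2
    rw [hm, transl_append, show height (drop m W) = - height (take m W) by omega, zpow_neg]
    have : (2 : ℚ) ^ height (take m W) ≠ 0 := by positivity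
    field_simp
    linarith
  geodesic u v hr' hl := h.geodesic u v (hr.trans hr') (by rwa [hr.perm.length_eq])

/-- The first letter commutes past `u` and the block `P`, and combines with `t a^{-s} = a^{-2s} t`.
-/
theorem not_geodesic_left {u : List Letter} (hu : height u = 0) (s : ℤˣ) {P : List ℤˣ}
    (hP : P.length ≤ 1) : ¬ Geodesic (a s :: (u ++ (P.map a ++ [t, a (-s)]))) := by
  match P, hP with
  | [], _ =>
    exact not_geodesic_of_shorter (u ++ [a (-s), t]) (by simp [hu]; ring) (by simp [hu]) (by simp)
  | [x], _ =>
    rcases units_eq_or_eq_neg s x with rfl | rfl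
    · exact not_geodesic_of_shorter (u ++ [t]) (by simp [hu]; ring) (by simp [hu]) (by simp)
    · exact not_geodesic_of_shorter (u ++ [t, a (-s)]) (by simp [hu]; ring) (by simp [hu]) (by simp)

theorem not_geodesic_right {u : List Letter} (hu : height u = 0) (s : ℤˣ) {Q : List ℤˣ}
    (hQ : Q.length ≤ 1) : ¬ Geodesic (a (-s) :: tInv :: (Q.map a ++ (u ++ [a s]))) := by
  match Q, hQ with
  | [], _ =>
    exact not_geodesic_of_shorter (tInv :: a (-s) :: u) (by simp [hu]; ring) (by simp [hu])
      (by simp)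
  | [x], _ =>
    rcases units_eq_or_eq_neg s x with rfl | rfl
    · exact not_geodesic_of_shorter (tInv :: u) (by simp [hu]; ring) (by simp [hu]) (by simp)
    · exact not_geodesic_of_shorter (a (-s) :: tInv :: u) (by simp [hu])
        (by simp [hu]) (by simp)

theorem not_geodesic_conj {u : List Letter} (hu : height u = 0) (s : ℤˣ) :
    ¬ Geodesic (a s :: (u ++ [a (-s)])) :=
  not_geodesic_of_shorter u (by simp [hu]) (by simp [hu]) (by simp)

theorem transl_replicate (k : ℕ) (s : ℤˣ) :
    transl ((replicate k s).map a) = ((k * (s : ℤ) : ℤ) : ℚ) := by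
  rw [transl_map_a]; simp

/-- Only `|z| = 6` needs more than a power of `a`: there `a⁶ = t a³ t⁻¹` has length 5. -/
theorem exists_length_le_five {z : ℤ} (hz : |z| ≤ 6) :
    ∃ w : List Letter, transl w = z ∧ height w = 0 ∧ w.length ≤ 5 := by
  obtain ⟨s, k, rfl, hk⟩ : ∃ (s : ℤˣ) (k : ℕ), z = k * (s : ℤ) ∧ k ≤ 6 := by
    rcases le_total 0 z with h | h
    · exact ⟨1, z.toNat, by simp [h], by rw [abs_le] at hz; omega⟩
    · exact ⟨-1, (-z).toNat, by simp [h], by rw [abs_le] at hz; omega⟩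
  rcases hk.lt_or_eq with hk | rfl
  · exact ⟨(replicate k s).map a, transl_replicate k s, height_map_a _, by simp; omega⟩
  · exact ⟨[t, a s, a s, a s, tInv], by simp; ring, by simp, by simp⟩

theorem abs_units_sum_le {P Q : List ℤˣ} (h : P.length + Q.length ≤ 1) :
    |(P.map (fun s : ℤˣ => (s : ℤ))).sum + (Q.map (fun s : ℤˣ => (s : ℤ))).sum| ≤ 1 := by
  have key : ∀ x : ℤˣ, |(x : ℤ)| ≤ 1 := fun x => by
    rcases Int.units_eq_one_or x with rfl | rfl <;> simp
  match P, Q, h with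
  | [], [], _ => simp
  | [x], [], _ => simpa using key x
  | [], [x], _ => simpa using key x
  | _ :: _ :: _, Q, h => simp at h; omega
  | [_], _ :: _, h => simp at h
  | [], _ :: _ :: _, h => simp at h

theorem transl_excursion {P Q : List ℤˣ} {M : List Letter} (hM : height M = 0) :
    transl (P.map a ++ t :: (M ++ tInv :: Q.map a)) =
    (((P.map (fun s : ℤˣ => (s : ℤ))).sum + (Q.map (fun s : ℤˣ => (s : ℤ))).sum : ℤ) : ℚ) +
      2 * transl M := by
  simp [hM]
  ring

/-- With equal signs the sum has absolute value at least 2 + 2 - 1. The factor `m` is 1 for a power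
of `a` and 2 for an excursion over one; `e` collects the letters beside the excursion. -/
theorem opposite_of_small_sum {k l : ℕ} {s s' : ℤˣ} {e m : ℤ} (hk : 2 ≤ k) (hl : 2 ≤ l)
    (hm : 1 ≤ m) (he : |e| ≤ 1)
    (h : |k * (s : ℤ) + (e + m * (l * (s' : ℤ)))| ≤ 1) : s' = -s := by
  rcases units_eq_or_eq_neg s s' with rfl | rfl
  · exfalso
    have h1 : (2 : ℤ) ≤ m * l := by
      have : (2 : ℤ) ≤ l := by exact_mod_cast hl
      nlinarith
    rw [abs_le] at h he
    rcases Int.units_eq_one_or s' with rfl | rfl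
    · simp at h; omega
    · simp at h; omega
  · rfl

/-- The base cases of the descent in `CyclicallyGeodesic.not_isRotated_excursions`. -/
theorem CyclicallyGeodesic.not_isRotated_replicate {k : ℕ} {s : ℤˣ} {M u u' W : List Letter}
    (hW : CyclicallyGeodesic W) (hr : W ~r (replicate k s).map a ++ (u ++ (M ++ u')))
    (hu : height u = 0) (hu' : height u' = 0) (hM : Motzkin M)
    (hg : Geodesic (t :: ((replicate k s).map a ++ [tInv]))) (hg' : Geodesic (t :: (M ++ [tInv])))
    (hX : |transl ((replicate k s).map a) + transl M| ≤ 1) : False := by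
  have hk := two_le_of_geodesic_excursion hg
  have hk5 : k ≤ 5 :=
    replicate_le_five (Geodesic.infix (p := [t]) (q := [tInv]) (by simpa using hg))
  have hgM : Geodesic M := Geodesic.infix (p := [t]) (q := [tInv]) (by simpa using hg')
  have hlen := hr.perm.length_eq
  obtain ⟨j, rfl⟩ := Nat.exists_eq_add_of_le' hk
  rcases hM.geodesic_cases hgM with ⟨l, s', rfl⟩ | ⟨P, Q, M', hM', hgM', hPQ, rfl⟩
  · have hl := two_le_of_geodesic_excursion hg'
    rw [transl_replicate, transl_replicate] at hX
    obtain rfl : s' = -s := opposite_of_small_sum (e := 0) (m := 1) hk hl le_rfl (by simp) (by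
      have : |(((j + 2 : ℕ) * (s : ℤ) + (0 + 1 * (l * (s' : ℤ))) : ℤ) : ℚ)| ≤ 1 := by
        convert hX using 2; push_cast; ring
      exact_mod_cast this)
    obtain ⟨i, rfl⟩ := Nat.exists_eq_add_of_le' hl
    simp at hlen
    -- Each block has at least two letters, so the arcs across `u` and across `u'` can use different
    -- letters. They are disjoint, hence one has at most half the length.
    by_cases hc : 2 * (u.length + 2) ≤ W.length
    · refine not_geodesic_conj hu s (hW.geodesic (a s :: (u ++ [a (-s)]))
        ((replicate (i + 1) (-s)).map a ++ (u' ++ (replicate (j + 1) s).map a)) ?_ (by simpa using hc))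
      refine hr.trans ?_
      have := isRotated_append (l := (replicate (j + 1) s).map a)
        (l' := a s :: (u ++ ((replicate (i + 2) (-s)).map a ++ u')))
      convert this using 1
      · rw [replicate_succ', map_append]; simp
      · simp [replicate_succ]
    · refine not_geodesic_conj hu' (-s) (hW.geodesic (a (-s) :: (u' ++ [a (- -s)]))
        ((replicate (j + 1) s).map a ++ (u ++ (replicate (i + 1) (-s)).map a)) ?_
        (by simp; omega))
      refine hr.trans ?_
      have := isRotated_append (l := (replicate (j + 2) s).map a ++ (u ++
        (replicate (i + 1) (-s)).map a)) (l' := a (-s) :: u')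
      convert this using 1
      · rw [replicate_succ' (n := i + 1), map_append]; simp
      · simp [replicate_succ]
  -- The power of `a` has exponent at most 5 and the translations add up to at most 1 in absolute
  -- value, so this factor translates by at most 6.
  · have h5 : (P.map a ++ t :: (M' ++ tInv :: Q.map a)).length ≤ 5 := by
      obtain ⟨z, hz⟩ := hM.exists_int
      rw [transl_replicate, hz] at hX
      have hX' : |((j + 2 : ℕ) * (s : ℤ) + z : ℤ)| ≤ 1 := by exact_mod_cast hX
      obtain ⟨w, hw, hw', hwl⟩ := exists_length_le_five (z := z) (by
        rw [abs_le] at hX' ⊢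
        rcases Int.units_eq_one_or s with rfl | rfl <;> push_cast at hX' <;> constructor <;> omega)
      exact (hgM w (by rw [hw, hz]) (by rw [hw', hM.height_eq])).trans hwl
    have hgM'' : Geodesic M' := Geodesic.infix (p := [t]) (q := [tInv]) (by simpa using hgM')
    rcases hM'.geodesic_cases hgM'' with ⟨l, s', rfl⟩ | ⟨P', Q', M'', hM'', hg'', -, rfl⟩
    -- A second nested excursion would contain at least two letters besides two `t` and two `t⁻¹`,
    -- six in all.
    swap
    · have := hM''.two_le_length hg''
      simp at h5; omega
    have hl := two_le_of_geodesic_excursion hgM'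
    rw [transl_replicate, transl_excursion hM'.height_eq, transl_replicate] at hX
    obtain rfl : s' = -s := opposite_of_small_sum (m := 2) hk hl (by simp)
      (abs_units_sum_le hPQ) (by exact_mod_cast hX)
    obtain ⟨i, rfl⟩ := Nat.exists_eq_add_of_le' hl
    simp at hlen
    -- Again the two arcs are disjoint; one passes the `t` of the excursion and the other its `t⁻¹`.
    by_cases hc : 2 * (u.length + P.length + 3) ≤ W.length
    · refine not_geodesic_left hu s (P := P) (by omega)
        (hW.geodesic (a s :: (u ++ (P.map a ++ [t, a (-s)])))
        ((replicate (i + 1) (-s)).map a ++ (tInv :: Q.map a ++ (u' ++ (replicate (j + 1) s).map a)))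
        ?_ (by simp; omega))
      refine hr.trans ?_
      have := isRotated_append (l := (replicate (j + 1) s).map a)
        (l' := a s :: (u ++ (P.map a ++ t :: ((replicate (i + 2) (-s)).map a ++ tInv ::
          Q.map a) ++ u')))
      convert this using 1
      · rw [replicate_succ' (n := j + 1), map_append]; simp
      · simp [replicate_succ]
    · refine not_geodesic_right hu' s (Q := Q) (by omega)
        (hW.geodesic (a (-s) :: tInv :: (Q.map a ++ (u' ++ [a s])))
        ((replicate (j + 1) s).map a ++ (u ++ (P.map a ++ t :: (replicate (i + 1) (-s)).map a)))
        ?_ (by simp; omega))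
      refine hr.trans ?_
      have := isRotated_append (l := (replicate (j + 2) s).map a ++ (u ++
        (P.map a ++ t :: (replicate (i + 1) (-s)).map a))) (l' := a (-s) :: tInv :: (Q.map a ++ u'))
      convert this using 1
      · rw [replicate_succ' (n := i + 1), map_append]; simp
      · simp [replicate_succ]

/-- Induction on the nesting: when both words are excursions, their outer layers are absorbed into
the separators `u` and `u'`, which keep height 0. `N` bounds the length of the first word. -/
theorem CyclicallyGeodesic.not_isRotated_excursions {W : List Letter} (hW : CyclicallyGeodesic W)
    (N : ℕ) : ∀ {M M' u u' : List Letter}, M.length ≤ N → W ~r M ++ (u ++ (M' ++ u')) →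
    height u = 0 → height u' = 0 → Motzkin M → Motzkin M' → Geodesic (t :: (M ++ [tInv])) →
    Geodesic (t :: (M' ++ [tInv])) → |transl M + transl M'| ≤ 1 → False := by
  induction N with
  | zero =>
    intro M M' u u' hN _ _ _ hM _ hg _ _
    have := hM.two_le_length hg
    omega
  | succ N ih =>
    intro M M' u u' hN hr hu hu' hM hM' hg hg' hX
    rcases hM.geodesic_cases (Geodesic.infix (p := [t]) (q := [tInv]) (by simpa using hg)) with
      ⟨k, s, rfl⟩ | ⟨P₁, Q₁, N₁, hN₁, hgN₁, hPQ₁, rfl⟩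
    · exact hW.not_isRotated_replicate hr hu hu' hM' hg hg' hX
    rcases hM'.geodesic_cases (Geodesic.infix (p := [t]) (q := [tInv]) (by simpa using hg')) with
      ⟨k, s, rfl⟩ | ⟨P₂, Q₂, N₂, hN₂, hgN₂, hPQ₂, rfl⟩
    · refine hW.not_isRotated_replicate (u := u') (u' := u) (hr.trans ?_) hu' hu hM hg' hg
        (by rwa [add_comm])
      generalize P₁.map a ++ t :: (N₁ ++ tInv :: Q₁.map a) = M
      simpa using isRotated_append (l := M ++ u) (l' := (replicate k s).map a ++ u')
    refine ih (M := N₁) (M' := N₂) (u := tInv :: (Q₁.map a ++ (u ++ (P₂.map a ++ [t]))))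
      (u' := tInv :: (Q₂.map a ++ (u' ++ (P₁.map a ++ [t])))) ?_ (hr.trans ?_) (by simp [hu])
      (by simp [hu']) hN₁ hN₂ hgN₁ hgN₂ ?_
    · simp at hN; omega
    · simpa using isRotated_append (l := P₁.map a ++ [t]) (l' := N₁ ++ tInv :: (Q₁.map a ++
        (u ++ (P₂.map a ++ t :: (N₂ ++ tInv :: (Q₂.map a ++ u'))))))
    · rw [transl_excursion hN₁.height_eq, transl_excursion hN₂.height_eq] at hX
      obtain ⟨y, hy⟩ := hN₁.exists_int
      obtain ⟨z, hz⟩ := hN₂.exists_int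
      have h₁ := abs_units_sum_le hPQ₁
      have h₂ := abs_units_sum_le hPQ₂
      rw [hy, hz] at hX ⊢
      generalize (P₁.map (fun s : ℤˣ => (s : ℤ))).sum + (Q₁.map (fun s : ℤˣ => (s : ℤ))).sum = e₁
        at *
      generalize (P₂.map (fun s : ℤˣ => (s : ℤ))).sum + (Q₂.map (fun s : ℤˣ => (s : ℤ))).sum = e₂
        at *
      have hX' : |(e₁ + 2 * y) + (e₂ + 2 * z)| ≤ 1 := by exact_mod_cast hX
      -- `2 |y + z| ≤ 1 + |e₁| + |e₂| ≤ 3`, and `y + z` is an integer.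
      have : |y + z| ≤ 1 := by rw [abs_le] at *; omega
      exact_mod_cast this

/-- Between `t⁻¹` and `t` there is exactly one letter. -/
theorem CyclicallyGeodesic.eq_singleton {W r : List Letter} {S : List ℤˣ}
    (hW : CyclicallyGeodesic W) (h6 : 6 ≤ W.length)
    (hr : W ~r tInv :: (S.map a ++ t :: r)) : ∃ s, S = [s] := by
  match S, hr with
  | [], hr =>
    exact absurd (hW.geodesic [tInv, t] r (by simpa using hr) (by simp; omega)) not_geodesic_tInv_t
  | [s], _ => exact ⟨s, rfl⟩
  | x :: y :: S, hr =>
    exfalso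
    obtain ⟨R, x, y, hR⟩ : ∃ R x' y', (x :: y :: S : List ℤˣ) = R ++ [x', y'] := by
      refine ⟨(x :: y :: S).dropLast.dropLast, (x :: y :: S).dropLast.getLast (by simp),
        (x :: y :: S).getLast (by simp), ?_⟩
      have h1 := dropLast_append_getLast (l := x :: y :: S) (by simp)
      have h2 := dropLast_append_getLast (l := (x :: y :: S).dropLast) (by simp)
      conv_lhs => rw [← h1, ← h2]
      simp only [append_assoc, cons_append, nil_append]
    rw [hR] at hr
    refine not_geodesic_a_a_t x y (hW.geodesic [a x, a y, t] (r ++ tInv :: R.map a)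
      (hr.trans ?_) (by simp; omega))
    simpa using isRotated_append (l := tInv :: R.map a) (l' := a x :: a y :: t :: r)

theorem CyclicallyGeodesic.lt_of_sandwich {W M r : List Letter} {s s' : ℤˣ}
    (hW : CyclicallyGeodesic W) (hM : Motzkin M)
    (hr : W ~r a s :: t :: (M ++ tInv :: a s' :: r)) : W.length < 2 * (M.length + 4) := by
  by_contra! h
  exact not_geodesic_sandwich hM.height_eq s s'
    (hW.geodesic (a s :: t :: (M ++ [tInv, a s'])) r (by simpa using hr) (by simpa using h))

/-- A word in `a^{±1}` either has adjacent inverse letters or is a nontrivial power of `a`. -/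
theorem CyclicallyGeodesic.not_map_a {W : List Letter} {S : List ℤˣ}
    (hW : CyclicallyGeodesic W) (h6 : 6 ≤ W.length) (hr : W ~r S.map a) : False := by
  have key : ∀ (s : ℤˣ) (S : List ℤˣ), (∃ p x q, s :: S = p ++ x :: -x :: q) ∨
      s :: S = replicate (S.length + 1) s := by
    intro s S
    induction S generalizing s with
    | nil => simp
    | cons y S ih =>
      rcases units_eq_or_eq_neg s y with rfl | rfl
      · rcases ih y with ⟨p, x, q, h⟩ | h
        · exact .inl ⟨y :: p, x, q, by simp [h]⟩
        · right
          conv_lhs => rw [h]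
          rfl
      · exact .inl ⟨[], s, S, rfl⟩
  match S, hr with
  | [], hr => simp at hr; simp [hr] at h6
  | s :: S, hr =>
    rcases key s S with ⟨p, x, q, h⟩ | h
    · rw [h] at hr
      refine not_geodesic_cancel x (hW.geodesic _ (q.map a ++ p.map a) (hr.trans ?_)
        (by simp; omega))
      simpa using isRotated_append (l := p.map a) (l' := a x :: a (-x) :: q.map a)
    · rw [h] at hr
      have := (hW.isRotated hr).transl_eq
      rw [transl_replicate] at this
      rcases Int.units_eq_one_or s with rfl | rfl
      · norm_cast at this; simp at this; omega
      · have h2 : ((S.length + 1 : ℕ) : ℤ) * ((-1 : ℤˣ) : ℤ) = 0 := by exact_mod_cast this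
        simp at h2; omega

theorem CyclicallyGeodesic.not_two_excursions {W M M' : List Letter} {s s' : ℤˣ}
    (hW : CyclicallyGeodesic W) (hM : Motzkin M) (hM' : Motzkin M')
    (hr : W ~r t :: (M ++ tInv :: a s :: t :: (M' ++ [tInv, a s']))) : False := by
  have hlen := hr.perm.length_eq
  have hr' : W ~r t :: (M' ++ tInv :: a s' :: t :: (M ++ [tInv, a s])) := hr.trans (by
    simpa using isRotated_append (l := t :: (M ++ [tInv, a s]))
      (l' := t :: (M' ++ [tInv, a s'])))
  have h1 := hW.lt_of_sandwich (s := s') (s' := s) (r := t :: (M' ++ [tInv])) hM (hr'.trans (by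
    simpa using isRotated_append (l := t :: (M' ++ [tInv]))
      (l' := a s' :: t :: (M ++ [tInv, a s]))))
  have h2 := hW.lt_of_sandwich (s := s) (s' := s') (r := t :: (M ++ [tInv])) hM' (hr.trans (by
    simpa using isRotated_append (l := t :: (M ++ [tInv]))
      (l' := a s :: t :: (M' ++ [tInv, a s']))))
  simp at hlen
  -- By `h1` and `h2` the lengths of `M` and `M'` differ by at most 1, so each of `t M t⁻¹` and `t
  -- M' t⁻¹` has at most half the total length and is geodesic.
  refine hW.not_isRotated_excursions M.length (M := M) (M' := M') (u := [tInv, a s, t])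
    (u' := [tInv, a s', t]) le_rfl (hr.trans ?_) (by simp) (by simp) hM hM'
    (hW.geodesic _ (a s :: t :: (M' ++ [tInv, a s'])) (by simpa using hr) (by simp; omega))
    (hW.geodesic _ (a s' :: t :: (M ++ [tInv, a s])) (by simpa using hr') (by simp; omega)) ?_
  · simpa using isRotated_append (l := [t]) (l' := M ++ tInv :: a s :: t :: (M' ++ [tInv, a s']))
  · have hX := (hW.isRotated hr).transl_eq
    obtain ⟨y, hy⟩ := hM.exists_int
    obtain ⟨z, hz⟩ := hM'.exists_int
    simp [hM.height_eq, hM'.height_eq, hy, hz] at hX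
    have hX' : 2 * (y + z) + s + s' = 0 := by
      have : ((2 * (y + z) + s + s' : ℤ) : ℚ) = 0 := by push_cast; linarith
      exact_mod_cast this
    rw [hy, hz]
    have : |y + z| ≤ 1 := by
      rw [abs_le]
      rcases Int.units_eq_one_or s with rfl | rfl <;>
        rcases Int.units_eq_one_or s' with rfl | rfl <;> simp at hX' <;> omega
    exact_mod_cast this

/-- A word representing the identity all of whose cyclic subwords of at most half its length are
geodesic has length at most `5`. -/
theorem CyclicallyGeodesic.length_le {W : List Letter} (hW : CyclicallyGeodesic W) :
    W.length ≤ 5 := by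
  by_contra! h6
  obtain ⟨W', hr, hM⟩ := exists_isRotated_motzkin hW.height_eq
  rcases hM.parse with ⟨S, rfl⟩ | ⟨S, M₁, q, hM₁, hq, rfl⟩
  · exact hW.not_map_a h6 hr
  have hr₁ : W ~r t :: (M₁ ++ tInv :: (q ++ S.map a)) := hr.trans (by
    simpa using isRotated_append (l := S.map a) (l' := t :: (M₁ ++ tInv :: q)))
  have hq₁ := hq.append (.map_a S)
  generalize q ++ S.map a = q₁ at hr₁ hq₁
  have hlen := hr₁.perm.length_eq
  rcases hq₁.parse with ⟨S₁, rfl⟩ | ⟨S₁, M₂, q₂, hM₂, hq₂, rfl⟩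
  · obtain ⟨s, rfl⟩ := hW.eq_singleton h6 (r := M₁) (S := S₁) (hr₁.trans (by
      simpa using isRotated_append (l := t :: M₁) (l' := tInv :: S₁.map a)))
    have hX := (hW.isRotated hr₁).transl_eq
    obtain ⟨y, hy⟩ := hM₁.exists_int
    simp [hM₁.height_eq, hy] at hX
    have hX' : 2 * y + s = 0 := by
      have : ((2 * y + s : ℤ) : ℚ) = 0 := by push_cast; linarith
      exact_mod_cast this
    -- With a single excursion the total translation `2 y ± 1` is odd.
    rcases Int.units_eq_one_or s with rfl | rfl <;> simp at hX' <;> omega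
  obtain ⟨s₁, rfl⟩ := hW.eq_singleton h6 (S := S₁) (r := M₂ ++ tInv :: (q₂ ++ t :: M₁))
    (hr₁.trans (by
      simpa using isRotated_append (l := t :: M₁)
        (l' := tInv :: (S₁.map a ++ t :: (M₂ ++ tInv :: q₂)))))
  rcases hq₂.parse with ⟨S₂, rfl⟩ | ⟨S₂, M₃, q₃, hM₃, hq₃, rfl⟩
  · obtain ⟨s₂, rfl⟩ := hW.eq_singleton h6 (S := S₂) (r := M₁ ++ tInv :: a s₁ :: t :: M₂)
      (hr₁.trans (by
      simpa using isRotated_append (l := t :: (M₁ ++ tInv :: a s₁ :: t :: M₂))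
        (l' := tInv :: S₂.map a)))
    exact hW.not_two_excursions hM₁ hM₂ (by simpa using hr₁)
  obtain ⟨s₂, rfl⟩ := hW.eq_singleton h6 (S := S₂)
    (r := M₃ ++ tInv :: (q₃ ++ t :: (M₁ ++ tInv :: a s₁ :: t :: M₂)))
    (hr₁.trans (by
      simpa using isRotated_append (l := t :: (M₁ ++ tInv :: a s₁ :: t :: M₂))
        (l' := tInv :: (S₂.map a ++ t :: (M₃ ++ tInv :: q₃)))))
  have hr₃ : W ~r tInv :: (q₃ ++ (t :: (M₁ ++ tInv :: a s₁ :: t :: (M₂ ++ tInv :: a s₂ ::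
      t :: M₃)))) := hr₁.trans (by
    simpa using isRotated_append (l := t :: (M₁ ++ tInv :: a s₁ :: t :: (M₂ ++ tInv :: a s₂ ::
      t :: M₃))) (l' := tInv :: q₃))
  -- The last `t⁻¹` shown in `hr₃` cannot be followed cyclically by `t`, so `q₃` begins with a
  -- letter `a^{±1}`.
  cases hq₃ with
  | nil =>
    obtain ⟨s, hs⟩ := hW.eq_singleton h6 (S := []) (by simpa using hr₃)
    simp at hs
  | up u v _ _ =>
    obtain ⟨s, hs⟩ := hW.eq_singleton h6 (S := []) (by simpa using hr₃)
    simp at hs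
  | a s₃ q₄ _ =>
    have h1 := hW.lt_of_sandwich hM₂ (s := s₁) (s' := s₂)
      (r := t :: (M₃ ++ tInv :: a s₃ :: (q₄ ++ t :: (M₁ ++ [tInv])))) (hr₁.trans (by
        simpa using isRotated_append (l := t :: (M₁ ++ [tInv])) (l' := a s₁ :: t :: (M₂ ++ tInv ::
          a s₂ :: t :: (M₃ ++ tInv :: a s₃ :: q₄)))))
    have h2 := hW.lt_of_sandwich hM₃ (s := s₂) (s' := s₃)
      (r := q₄ ++ t :: (M₁ ++ tInv :: a s₁ :: t :: (M₂ ++ [tInv]))) (hr₁.trans (by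
        simpa using isRotated_append (l := t :: (M₁ ++ tInv :: a s₁ :: t :: (M₂ ++ [tInv])))
          (l' := a s₂ :: t :: (M₃ ++ tInv :: a s₃ :: q₄))))
    -- The sandwiches around `M₂` and `M₃` share one letter, and the cycle also contains `t M₁ t⁻¹`;
    -- both cannot exceed half the length.
    simp at hlen
    omega

end Letter

end ShortcutGraph

/-! ### The group BS(1,2) and its faithful affine action -/

namespace ShortcutGraph

open List

namespace BS12

/-- The generator `a` of `BS(1,2)`. -/
def genA : BS12 := PresentedGroup.of BSGen.a

/-- The generator `t` of `BS(1,2)`. -/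
def genT : BS12 := PresentedGroup.of BSGen.t

theorem genT_mul_genA : genT * genA = genA ^ 2 * genT := by
  have h : PresentedGroup.mk bsRels (FreeGroup.of BSGen.t * FreeGroup.of BSGen.a *
      (FreeGroup.of BSGen.t)⁻¹ * (FreeGroup.of BSGen.a ^ 2)⁻¹) = 1 :=
    PresentedGroup.one_of_mem rfl
  rw [map_mul, map_mul, map_mul, map_inv, map_inv, map_pow] at h
  have h' : genT * genA * genT⁻¹ * (genA ^ 2)⁻¹ = 1 := h
  rw [mul_inv_eq_one, mul_inv_eq_iff_eq_mul] at h'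
  exact h'

theorem semiconjBy_genT : SemiconjBy genT genA (genA ^ 2) := genT_mul_genA

/-- The affine maps given by the generators. -/
def affineGen : BSGen → Equiv.Perm ℚ
  | .a => Equiv.addRight 1
  | .t => Equiv.mulRight₀ 2 two_ne_zero

/-- The affine action on `ℚ` in which `a` is translation by `1` and `t` is doubling. -/
def affineHom : BS12 →* Equiv.Perm ℚ :=
  PresentedGroup.toGroup (f := affineGen) (by
    intro r hr
    rw [bsRels, Set.mem_singleton_iff] at hr
    subst hr
    rw [map_mul, map_mul, map_mul, map_inv, map_inv, map_pow, mul_inv_eq_one,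
      mul_inv_eq_iff_eq_mul, FreeGroup.lift_apply_of, FreeGroup.lift_apply_of]
    ext x
    simp [affineGen, pow_two]
    ring)

/-- The exponents of `t` in the generators. -/
def heightGen : BSGen → Multiplicative ℤ
  | .a => 1
  | .t => Multiplicative.ofAdd 1

/-- The exponent sum in `t`. -/
def heightHom : BS12 →* Multiplicative ℤ :=
  PresentedGroup.toGroup (f := heightGen) (by
    intro r hr
    rw [bsRels, Set.mem_singleton_iff] at hr
    subst hr
    simp [heightGen])

/-- The exponent sum in `t`, as an integer. -/
def height (g : BS12) : ℤ := (heightHom g).toAdd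

/-- The image of `0` under the affine action. -/
def transl (g : BS12) : ℚ := affineHom g 0

@[simp] theorem affineHom_genA (x : ℚ) : affineHom genA x = x + 1 := by
  simp [affineHom, affineGen, genA]

@[simp] theorem affineHom_genT (x : ℚ) : affineHom genT x = x * 2 := by
  simp [affineHom, affineGen, genT]

@[simp] theorem affineHom_genA_inv (x : ℚ) : affineHom genA⁻¹ x = x - 1 := by
  rw [map_inv, Equiv.Perm.inv_eq_iff_eq]; simp

@[simp] theorem affineHom_genT_inv (x : ℚ) : affineHom genT⁻¹ x = x / 2 := by
  rw [map_inv, Equiv.Perm.inv_eq_iff_eq]; simp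

@[simp] theorem height_genA : height genA = 0 := by simp [height, heightHom, heightGen, genA]
@[simp] theorem height_genT : height genT = 1 := by simp [height, heightHom, heightGen, genT]
@[simp] theorem height_one : height 1 = 0 := by simp [height]
@[simp] theorem height_mul (g h : BS12) : height (g * h) = height g + height h := by simp [height]
@[simp] theorem height_inv (g : BS12) : height g⁻¹ = - height g := by simp [height]

@[simp] theorem transl_one : transl 1 = 0 := by simp [transl]

/-- The group element of a letter. -/
def ofLetter : Letter → BS12
  | .a s => genA ^ (s : ℤ)
  | .t => genT
  | .tInv => genT⁻¹

/-- The group element represented by a word. -/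
def eval (w : List Letter) : BS12 := (w.map ofLetter).prod

@[simp] theorem eval_nil : eval [] = 1 := rfl
@[simp] theorem eval_cons (x w) : eval (x :: w) = ofLetter x * eval w := by simp [eval]
@[simp] theorem eval_append (u v) : eval (u ++ v) = eval u * eval v := by simp [eval]

@[simp] theorem height_eval (w : List Letter) : height (eval w) = Letter.height w := by
  induction w with
  | nil => simp
  | cons x w ih =>
    rcases x with s | - | -
    · rcases Int.units_eq_one_or s with rfl | rfl <;> simp [ofLetter, ih]
    · simp [ofLetter, ih, add_comm]
    · simp [ofLetter, ih]; ring

@[simp] theorem transl_eval (w : List Letter) : transl (eval w) = Letter.transl w := by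
  induction w with
  | nil => simp
  | cons x w ih =>
    rw [transl] at ih
    rcases x with s | - | -
    · rcases Int.units_eq_one_or s with rfl | rfl <;>
        simp [transl, ofLetter, ih, map_mul, -map_inv] <;> ring
    · simp [transl, ofLetter, ih]; ring
    · simp [transl, ofLetter, ih, -map_inv]

theorem exists_eval_eq (g : BS12) : ∃ w, eval w = g := by
  have hinv : ∀ w, ∃ w', eval w' = (eval w)⁻¹ := by
    intro w
    induction w with
    | nil => exact ⟨[], by simp⟩
    | cons x w ih =>
      obtain ⟨w', hw'⟩ := ih
      rcases x with s | - | -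
      · exact ⟨w' ++ [.a (-s)], by simp [hw', ofLetter]⟩
      · exact ⟨w' ++ [.tInv], by simp [hw', ofLetter]⟩
      · exact ⟨w' ++ [.t], by simp [hw', ofLetter]⟩
  let K : Subgroup BS12 :=
    { carrier := {g | ∃ w, eval w = g}
      one_mem' := ⟨[], rfl⟩
      mul_mem' := by
        rintro _ _ ⟨u, rfl⟩ ⟨v, rfl⟩
        exact ⟨u ++ v, by simp⟩
      inv_mem' := by
        rintro _ ⟨u, rfl⟩
        exact hinv u }
  refine PresentedGroup.generated_by bsRels K (fun j => ?_) g
  cases j with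
  | a => exact ⟨[.a 1], by simp [ofLetter, genA]⟩
  | t => exact ⟨[.t], by simp [ofLetter, genT]⟩

theorem genT_pow_mul_genA_zpow (n : ℕ) (k : ℤ) :
    genT ^ n * genA ^ k = genA ^ (2 ^ n * k) * genT ^ n := by
  have h : SemiconjBy (genT ^ n) genA (genA ^ (2 ^ n)) := by
    induction n with
    | zero => simp
    | succ n ih =>
      rw [pow_succ', pow_succ', pow_mul]
      exact (semiconjBy_genT.pow_right _).mul_left ih
  have := (h.zpow_right k).eq
  rw [this, ← zpow_natCast, ← zpow_mul]
  norm_cast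

/-- Every element has the form `t⁻ⁱ aᵏ tʲ`. -/
theorem exists_normal_form (g : BS12) :
    ∃ (i j : ℕ) (k : ℤ), g = (genT ^ i)⁻¹ * genA ^ k * genT ^ j := by
  obtain ⟨w, rfl⟩ := exists_eval_eq g
  induction w with
  | nil => exact ⟨0, 0, 0, by simp⟩
  | cons x w ih =>
    obtain ⟨i, j, k, h⟩ := ih
    rw [eval_cons, h]
    rcases x with s | - | -
    · refine ⟨i, j, 2 ^ i * s + k, ?_⟩
      have := genT_pow_mul_genA_zpow i s
      rw [ofLetter, zpow_add, eq_mul_inv_of_mul_eq this.symm]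
      simp [mul_assoc]
    · rcases i with - | i
      · refine ⟨0, j + 1, 2 * k, ?_⟩
        have := genT_pow_mul_genA_zpow 1 k
        simp only [pow_one] at this
        simp [ofLetter, ← mul_assoc, this, pow_succ']
      · refine ⟨i, j, k, ?_⟩
        simp [ofLetter, pow_succ, mul_assoc]
    · exact ⟨i + 1, j, k, by simp [ofLetter, pow_succ, mul_assoc]⟩

theorem transl_mul_genA_zpow (k : ℤ) (g : BS12) : transl (genA ^ k * g) = k + transl g := by
  induction k with
  | zero => simp
  | succ k ih => rw [add_comm, zpow_add, mul_assoc, transl, map_mul, Equiv.Perm.mul_apply,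
      ← transl, ih]; simp; ring
  | pred k ih => rw [sub_eq_add_neg, add_comm, zpow_add, mul_assoc, transl, map_mul,
      Equiv.Perm.mul_apply, ← transl, ih, zpow_neg_one, affineHom_genA_inv]; simp; ring

theorem transl_genT_pow_mul (n : ℕ) (g : BS12) : transl (genT ^ n * g) = 2 ^ n * transl g := by
  induction n with
  | zero => simp
  | succ n ih => rw [pow_succ', mul_assoc, transl, map_mul, Equiv.Perm.mul_apply, ← transl, ih]
                 simp; ring

theorem height_genT_pow (n : ℕ) : height (genT ^ n) = n := by
  simp [height, heightHom, heightGen, genT]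

theorem height_genA_zpow (n : ℤ) : height (genA ^ n) = 0 := by
  simp [height, heightHom, heightGen, genA]

/-- The affine action is faithful. -/
theorem eq_one_of_transl_height {g : BS12} (hX : transl g = 0) (hH : height g = 0) : g = 1 := by
  obtain ⟨i, j, k, rfl⟩ := exists_normal_form g
  have h1 : transl (genT ^ j) = 0 := by simpa using transl_genT_pow_mul j 1
  simp only [height_mul, height_inv, height_genT_pow, height_genA_zpow] at hH
  obtain rfl : i = j := by omega
  -- Multiplying by `tⁱ` clears the denominator and leaves the translation part `k`.
  have h2 := transl_genT_pow_mul i ((genT ^ i)⁻¹ * genA ^ k * genT ^ i)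
  rw [hX, mul_assoc, mul_inv_cancel_left, transl_mul_genA_zpow, h1] at h2
  have : k = 0 := by simpa using h2
  simp [this]

end BS12

end ShortcutGraph

/-! ### The Cayley graph and its isometric cycles -/

namespace ShortcutGraph

open List

namespace BS12

theorem transl_mul (g h : BS12) : transl (g * h) = transl g + 2 ^ height g * transl h := by
  obtain ⟨u, rfl⟩ := exists_eval_eq g
  obtain ⟨v, rfl⟩ := exists_eval_eq h
  rw [← eval_append, transl_eval, transl_eval, transl_eval, height_eval, Letter.transl_append]

theorem transl_inv (g : BS12) : transl g⁻¹ = - (2 ^ (-height g) * transl g) := by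
  have := transl_mul g⁻¹ g
  simp only [inv_mul_cancel, transl_one, height_inv] at this
  linarith

/-- This links `Letter.Geodesic`, which only sees translation and height, to lengths of words in the
group. -/
theorem ext_of_transl_height {g h : BS12} (hX : transl g = transl h)
    (hH : height g = height h) : g = h := by
  rw [← inv_mul_eq_one]
  apply eq_one_of_transl_height
  · rw [transl_mul, transl_inv, height_inv, hX]; ring
  · rw [height_mul, height_inv, hH]; ring

theorem bsCayley_adj_ofLetter (g : BS12) (x : Letter) : bsCayley.Adj g (g * ofLetter x) := by
  have hne : ofLetter x ≠ 1 := by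
    intro h
    have hX : transl (eval [x]) = 0 := by simp [h]
    have hH : height (eval [x]) = 0 := by simp [h]
    rw [transl_eval] at hX
    rw [height_eval] at hH
    rcases x with s | - | -
    · simp at hX
    · simp at hH
    · simp at hH
  rw [bsCayley, SimpleGraph.mulCayley_adj']
  refine ⟨by simpa using hne, ?_⟩
  rcases x with s | - | -
  · rcases Int.units_eq_one_or s with rfl | rfl
    · exact ⟨genA, by simp [genA], .inl (by simp [ofLetter])⟩
    · exact ⟨genA, by simp [genA], .inr (by simp [ofLetter])⟩
  · exact ⟨genT, by simp [genT], .inl (by simp [ofLetter])⟩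
  · exact ⟨genT, by simp [genT], .inr (by simp [ofLetter])⟩

theorem exists_ofLetter_of_adj {g h : BS12} (hgh : bsCayley.Adj g h) :
    ∃ x, h = g * ofLetter x := by
  rw [bsCayley, SimpleGraph.mulCayley_adj'] at hgh
  obtain ⟨-, s, hs, h1⟩ := hgh
  rcases hs with rfl | rfl <;> rcases h1 with rfl | rfl
  · exact ⟨.a 1, by simp [ofLetter, genA]⟩
  · exact ⟨.a (-1), by simp [ofLetter, genA]⟩
  · exact ⟨.t, by simp [ofLetter, genT]⟩
  · exact ⟨.tInv, by simp [ofLetter, genT]⟩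

theorem exists_walk_eval (g : BS12) (w : List Letter) :
    ∃ p : bsCayley.Walk g (g * eval w), p.length = w.length := by
  induction w generalizing g with
  | nil => exact ⟨SimpleGraph.Walk.nil.copy rfl (by simp), by rw [SimpleGraph.Walk.length_copy]; rfl⟩
  | cons x w ih =>
    obtain ⟨p, hp⟩ := ih (g * ofLetter x)
    exact ⟨(SimpleGraph.Walk.cons (bsCayley_adj_ofLetter g x) p).copy rfl (by simp [mul_assoc]),
      by simp [hp]⟩

theorem dist_mul_eval_le (g : BS12) (w : List Letter) :
    bsCayley.dist g (g * eval w) ≤ w.length := by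
  obtain ⟨p, hp⟩ := exists_walk_eval g w
  exact hp ▸ SimpleGraph.dist_le p

theorem bsCayley_connected : bsCayley.Connected where
  preconnected g h := by
    obtain ⟨w, hw⟩ := exists_eval_eq (g⁻¹ * h)
    obtain ⟨p, -⟩ := exists_walk_eval g w
    exact ⟨p.copy rfl (by simp [hw])⟩

end BS12

theorem CycleIn.IsIsometric.le_dist {V : Type*} {Γ : SimpleGraph V} {n : ℕ} {f : CycleIn Γ n}
    (hf : f.IsIsometric) (k m : ℕ) (hm : 2 * m ≤ n) :
    m ≤ Γ.dist (f.vert k) (f.vert (k + m : ℕ)) := by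
  have h0 := f.length_pos
  have h1 := hf (k : ℝ) ((k + m : ℕ) : ℝ)
  have h2 : ‖(((k : ℝ) - ((k + m : ℕ) : ℝ) : ℝ) : AddCircle (n : ℝ))‖ = m := by
    rw [(AddCircle.norm_coe_eq_abs_iff (n : ℝ) (by positivity)).2]
    · simp
    · simp
      rw [le_div_iff₀ (by norm_num)]
      exact_mod_cast (by omega : m * 2 ≤ n)
  have h3 : (f.point k).dist (f.point ((k + m : ℕ) : ℝ)) ≤
      Γ.dist (f.vert k) (f.vert (k + m : ℕ)) := by
    have e1 : (f.point k).src = f.vert k := by simp [CycleIn.point]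
    have e2 : (f.point ((k + m : ℕ) : ℝ)).src = f.vert (k + m : ℕ) := by
      simp only [CycleIn.point, Int.floor_natCast, Int.cast_natCast]
    have p1 : (f.point k).pos = 0 := by simp [CycleIn.point]
    have p2 : (f.point ((k + m : ℕ) : ℝ)).pos = 0 := by
      simp only [CycleIn.point, Int.fract_natCast]
    rw [← e1, ← e2]
    generalize f.point k = p at *
    generalize f.point ((k + m : ℕ) : ℝ) = q at *
    unfold EdgePoint.dist
    split_ifs with hc hd
    · simp [p1, p2]
    -- Here the two points are the opposite ends of one edge, which the cycle traverses in both
    -- directions.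
    · have : Γ.dist p.src q.src = 1 := by
        rw [SimpleGraph.dist_eq_one_iff_adj, ← hd.2]; exact p.adj
      simp [p1, p2, this]
    · unfold EdgePoint.distVia
      refine (min_le_left _ _).trans ((min_le_left _ _).trans ?_)
      simp [p1, p2]
  rw [h1, h2] at h3
  exact_mod_cast h3

-- The word `w k m` labels the `m` edges after vertex `k`. Starting at another vertex rotates the
-- full word, so each cyclic subword labels an arc, to which `CycleIn.IsIsometric.le_dist` applies.
open BS12 in
theorem CycleIn.IsIsometric.length_le_five {n : ℕ} {f : CycleIn bsCayley n}
    (hf : f.IsIsometric) : n ≤ 5 := by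
  choose l hl using fun i => exists_ofLetter_of_adj (f.adj i)
  let w (k m : ℕ) : List Letter := (range m).map (fun i => l ((k + i : ℕ) : ZMod n))
  have hw : ∀ k m, f.vert ((k + m : ℕ) : ZMod n) = f.vert k * eval (w k m) := by
    intro k m
    induction m with
    | zero => simp [w]
    | succ m ih =>
      have : w k (m + 1) = w k m ++ [l ((k + m : ℕ) : ZMod n)] := by simp [w, range_succ]
      rw [this, eval_append, ← mul_assoc, ← ih]
      have := hl ((k + m : ℕ) : ZMod n)
      simpa [add_assoc] using this
  have hlen : ∀ k m, (w k m).length = m := fun k m => by simp [w]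
  have hrot : ∀ k, (w 0 n).rotate k = w k n := by
    intro k
    refine List.ext_getElem (by simp [w]) fun i h1 h2 => ?_
    rw [getElem_rotate]
    simp only [w, getElem_map, getElem_range, length_map, length_range]
    congr 1
    simp [add_comm]
  have h1 : eval (w 0 n) = 1 := by
    have := hw 0 n
    simpa using this
  have hcg : Letter.CyclicallyGeodesic (w 0 n) := by
    refine ⟨by rw [← transl_eval, h1, transl_one], by rw [← height_eval, h1, height_one], ?_⟩
    rintro u v ⟨k, hk⟩ hu u' hX hH
    rw [hrot] at hk
    rw [hlen] at hu
    have hu' : u = w k u.length := by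
      have h2 : u = (w k n).take u.length := by rw [hk]; simp
      conv_lhs => rw [h2]
      simp only [w, ← map_take, take_range]
      congr 2
      omega
    have h2 := hf.le_dist k u.length hu
    rw [hw, ← hu'] at h2
    have h3 : eval u = eval u' :=
      ext_of_transl_height (by simp [hX]) (by simp [hH])
    rw [h3] at h2
    exact h2.trans (dist_mul_eval_le _ _)
  simpa [hlen] using hcg.length_le

theorem isShortcut_bsCayley : IsShortcut bsCayley :=
  ⟨BS12.bsCayley_connected, 5, fun _ _ hf => hf.length_le_five⟩

theorem isGeometricAction_bsCayley : IsGeometricAction BS12 bsCayley where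
  adj_smul g v w h := by simpa [bsCayley] using h
  proper S := by
    refine ((S.finite_toSet.prod S.finite_toSet).image (fun p => p.2 * p.1⁻¹)).subset ?_
    rintro g ⟨v, hv, hgv⟩
    exact ⟨(v, g * v), ⟨hv, hgv⟩, by simp⟩
  cocompact := by
    classical
    refine ⟨{1, BS12.genA, BS12.genT, BS12.genA⁻¹, BS12.genT⁻¹}, fun v => ⟨v⁻¹, by simp⟩, ?_⟩
    intro v w h
    obtain ⟨x, rfl⟩ := BS12.exists_ofLetter_of_adj h
    refine ⟨v⁻¹, by simp, ?_⟩
    rcases x with s | - | -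
    · rcases Int.units_eq_one_or s with rfl | rfl <;> simp [BS12.ofLetter]
    · simp [BS12.ofLetter]
    · simp [BS12.ofLetter]

theorem isShortcutGroup_BS12 : IsShortcutGroup BS12 :=
  ⟨BS12, bsCayley, inferInstance, isShortcut_bsCayley, isGeometricAction_bsCayley⟩

end ShortcutGraph

/-! ### The flux through a half-space of the Bass-Serre tree -/

namespace ShortcutGraph

namespace BS12

/-- The elements with integral translation part and nonnegative height. They lie over a half-space
of the Bass-Serre tree. -/
def upper : Set BS12 := {g | 0 ≤ height g ∧ ∃ z : ℤ, transl g = z}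

/-- The indicator function of `upper`. -/
noncomputable def upperInd (g : BS12) : ℝ := upper.indicator 1 g

/-- Twice the horizontal displacement from `g` to `h`, as far as it takes place in `upper`. -/
noncomputable def flux (g h : BS12) : ℝ := (upperInd g + upperInd h) * (transl h - transl g)

theorem flux_self (g : BS12) : flux g g = 0 := by simp [flux]

theorem flux_comm (g h : BS12) : flux h g = - flux g h := by simp only [flux]; ring

theorem upperInd_mem_Icc (g : BS12) : upperInd g ∈ Set.Icc (0 : ℝ) 1 := by
  unfold upperInd
  by_cases h : g ∈ upper <;> simp [h]

theorem abs_flux_le (g h : BS12) : |flux g h| ≤ 2 * |(transl h - transl g : ℝ)| := by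
  have h1 := upperInd_mem_Icc g
  have h2 := upperInd_mem_Icc h
  rw [flux, abs_mul]
  gcongr
  rw [abs_of_nonneg (add_nonneg h1.1 h2.1)]
  linarith [h1.2, h2.2]

theorem exists_two_pow_mul_transl (g : BS12) : ∃ (n : ℕ) (z : ℤ), 2 ^ n * transl g = z := by
  obtain ⟨i, j, k, rfl⟩ := exists_normal_form g
  refine ⟨i, k, ?_⟩
  have h1 : transl (genT ^ j) = 0 := by simpa using transl_genT_pow_mul j 1
  rw [← transl_genT_pow_mul, mul_assoc, mul_inv_cancel_left, transl_mul_genA_zpow, h1, add_zero]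

/-- Right multiplication by `e` changes the translation part by `2 ^ height g * transl e`, an
integer once the height of `g` exceeds the exponent of the denominator. -/
theorem exists_upper_mul_iff (e : BS12) :
    ∃ N : ℕ, ∀ g, (N : ℤ) ≤ height g → (g * e ∈ upper ↔ g ∈ upper) := by
  obtain ⟨n, z, hz⟩ := exists_two_pow_mul_transl e
  refine ⟨n + (height e).natAbs, fun g hg => ?_⟩
  obtain ⟨m, hm⟩ : ∃ m : ℕ, height g = m + n := ⟨(height g - n).toNat, by omega⟩
  have hX : transl (g * e) = transl g + ((2 ^ m * z : ℤ) : ℚ) := by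
    rw [transl_mul, hm, zpow_add₀ two_ne_zero, mul_assoc, zpow_natCast, zpow_natCast, hz]
    push_cast
    rfl
  have h1 : 0 ≤ height (g * e) ↔ 0 ≤ height g := by rw [height_mul]; omega
  simp only [upper, Set.mem_ofPred_eq, h1, hX]
  refine and_congr_right fun _ => ⟨?_, ?_⟩
  · rintro ⟨y, hy⟩
    exact ⟨y - 2 ^ m * z, by push_cast at hy ⊢; linarith⟩
  · rintro ⟨y, hy⟩
    exact ⟨y + 2 ^ m * z, by push_cast; linarith⟩

theorem abs_transl_mul_sub_le {N : ℕ} {g : BS12} (hg : height g ≤ N) (e : BS12) :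
    |(transl (g * e) - transl g : ℝ)| ≤ 2 ^ N * |(transl e : ℝ)| := by
  rw [transl_mul]
  push_cast
  rw [add_sub_cancel_left, abs_mul, abs_of_nonneg (by positivity)]
  gcongr
  rw [← zpow_natCast]
  exact zpow_le_zpow_right₀ one_le_two hg

/-- The coboundary of the flux is bounded on triangles of given shape. -/
theorem exists_flux_triangle_le (e₁ e₂ : BS12) : ∃ C, ∀ g,
    |flux g (g * e₁) + flux (g * e₁) (g * e₂) - flux g (g * e₂)| ≤ C := by
  obtain ⟨N₁, h₁⟩ := exists_upper_mul_iff e₁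
  obtain ⟨N₂, h₂⟩ := exists_upper_mul_iff e₂
  set N := max N₁ N₂
  refine ⟨4 * (2 ^ N * |(transl e₁ : ℝ)|) + 4 * (2 ^ N * |(transl e₂ : ℝ)|), fun g => ?_⟩
  -- At low height all displacements are bounded. At large height the whole triangle lies inside or
  -- outside `upper`, and the three terms telescope to 0.
  rcases le_total (height g) N with hg | hg
  · have d₁ := abs_transl_mul_sub_le hg e₁
    have d₂ := abs_transl_mul_sub_le hg e₂
    have f₁ := abs_flux_le g (g * e₁)
    have f₂ := abs_flux_le g (g * e₂)
    have f₃ := abs_flux_le (g * e₁) (g * e₂)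
    have d₃ : |(transl (g * e₂) - transl (g * e₁) : ℝ)| ≤
        |(transl (g * e₁) - transl g : ℝ)| + |(transl (g * e₂) - transl g : ℝ)| := by
      rw [add_comm, abs_sub_comm (transl (g * e₁) : ℝ)]
      exact abs_sub_le _ _ _
    have t₁ := abs_sub (flux g (g * e₁) + flux (g * e₁) (g * e₂)) (flux g (g * e₂))
    have t₂ := abs_add_le (flux g (g * e₁)) (flux (g * e₁) (g * e₂))
    linarith
  · have i₁ : upperInd (g * e₁) = upperInd g := by
      have := h₁ g (le_trans (by exact_mod_cast le_max_left _ _) hg)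
      by_cases h : g ∈ upper <;> simp [upperInd, this, h]
    have i₂ : upperInd (g * e₂) = upperInd g := by
      have := h₂ g (le_trans (by exact_mod_cast le_max_right _ _) hg)
      by_cases h : g ∈ upper <;> simp [upperInd, this, h]
    have : flux g (g * e₁) + flux (g * e₁) (g * e₂) - flux g (g * e₂) = 0 := by
      simp only [flux, i₁, i₂]
      ring
    rw [this, abs_zero]
    positivity

theorem exists_flux_triangle_le_of_finite {F₁ F₂ : Set BS12} (h₁ : F₁.Finite) (h₂ : F₂.Finite) :
    ∃ C, ∀ g g₁ g₂, g⁻¹ * g₁ ∈ F₁ → g⁻¹ * g₂ ∈ F₂ →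
      |flux g g₁ + flux g₁ g₂ - flux g g₂| ≤ C := by
  choose C hC using fun p : BS12 × BS12 => exists_flux_triangle_le p.1 p.2
  obtain ⟨B, hB⟩ := ((h₁.prod h₂).image C).bddAbove
  refine ⟨B, fun g g₁ g₂ m₁ m₂ => ?_⟩
  have := hC (g⁻¹ * g₁, g⁻¹ * g₂) g
  simp only [mul_inv_cancel_left] at this
  exact this.trans (hB ⟨_, ⟨m₁, m₂⟩, rfl⟩)

theorem eq_one_of_isOfFinOrder {g : BS12} (hg : IsOfFinOrder g) : g = 1 := by
  obtain ⟨n, hn, h⟩ := isOfFinOrder_iff_pow_eq_one.1 hg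
  have hH : ∀ m : ℕ, height (g ^ m) = m * height g := by
    intro m
    induction m with
    | zero => simp
    | succ m ih => rw [pow_succ, height_mul, ih]; push_cast; ring
  have h0 : height g = 0 := by
    have := hH n
    rw [h, height_one] at this
    simpa [hn.ne'] using this.symm
  have hX : ∀ m : ℕ, transl (g ^ m) = m * transl g := by
    intro m
    induction m with
    | zero => simp
    | succ m ih => rw [pow_succ', transl_mul, ih, h0]; push_cast; ring
  refine eq_one_of_transl_height ?_ h0
  have := hX n
  rw [h, transl_one] at this
  simpa [hn.ne'] using this.symm

/-! ### The flux of the commutator words -/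

/-- The sum of the fluxes along a path labelled by `w` that starts at `g`. -/
noncomputable def wordFlux : BS12 → List Letter → ℝ
  | _, [] => 0
  | g, x :: w => flux g (g * ofLetter x) + wordFlux (g * ofLetter x) w

theorem wordFlux_append (g : BS12) (u v : List Letter) :
    wordFlux g (u ++ v) = wordFlux g u + wordFlux (g * eval u) v := by
  induction u generalizing g with
  | nil => simp [wordFlux]
  | cons x u ih => simp [wordFlux, ih, add_assoc, mul_assoc]

theorem flux_genT (g : BS12) : flux g (g * genT) = 0 := by
  have : transl genT = 0 := by simp [transl]
  simp [flux, transl_mul, this]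

theorem flux_genT_inv (g : BS12) : flux g (g * genT⁻¹) = 0 := by
  have := flux_genT (g * genT⁻¹)
  rw [inv_mul_cancel_right, flux_comm] at this
  linarith

theorem wordFlux_replicate_t (g : BS12) (n : ℕ) : wordFlux g (List.replicate n .t) = 0 := by
  induction n generalizing g with
  | zero => rfl
  | succ n ih => simp [List.replicate_succ, wordFlux, ofLetter, flux_genT, ih]

theorem wordFlux_replicate_tInv (g : BS12) (n : ℕ) :
    wordFlux g (List.replicate n .tInv) = 0 := by
  induction n generalizing g with
  | zero => rfl
  | succ n ih => simp [List.replicate_succ, wordFlux, ofLetter, flux_genT_inv, ih]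

theorem mul_ofLetter_a_mem_upper {g : BS12} {s : ℤˣ} :
    g * ofLetter (.a s) ∈ upper ↔ g ∈ upper := by
  have hH : height (g * ofLetter (.a s)) = height g := by simp [ofLetter, height_genA_zpow]
  have hX : transl (g * ofLetter (.a s)) = transl g + 2 ^ height g * s := by
    have : transl (ofLetter (.a s)) = s := by simpa [ofLetter] using transl_mul_genA_zpow s 1
    rw [transl_mul, this]
  simp only [upper, Set.mem_ofPred_eq, hH, hX]
  refine and_congr_right fun h => ?_
  obtain ⟨m, hm⟩ := Int.eq_ofNat_of_zero_le h
  rw [hm, zpow_natCast]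
  constructor
  · rintro ⟨y, hy⟩
    exact ⟨y - 2 ^ m * s, by push_cast; linarith⟩
  · rintro ⟨y, hy⟩
    exact ⟨y + 2 ^ m * s, by push_cast; linarith⟩

theorem flux_ofLetter_a (g : BS12) (s : ℤˣ) :
    flux g (g * ofLetter (.a s)) = 2 * upperInd g * (2 ^ height g * (s : ℤ)) := by
  have h : upperInd (g * ofLetter (.a s)) = upperInd g := by
    by_cases h : g ∈ upper <;> simp [upperInd, mul_ofLetter_a_mem_upper, h]
  have hX : transl (ofLetter (.a s)) = s := by simpa [ofLetter] using transl_mul_genA_zpow s 1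
  rw [flux, h, transl_mul, hX]
  push_cast
  ring

theorem upperInd_of_not_mem {g : BS12} (h : g ∉ upper) : upperInd g = 0 := by simp [upperInd, h]

theorem height_replicate_t (n : ℕ) : Letter.height (List.replicate n .t) = n := by
  induction n with
  | zero => simp
  | succ n ih => simp [List.replicate_succ, ih]

theorem height_replicate_tInv (n : ℕ) : Letter.height (List.replicate n .tInv) = -n := by
  induction n with
  | zero => simp
  | succ n ih => simp [List.replicate_succ, ih]; ring

theorem transl_replicate_t (n : ℕ) : Letter.transl (List.replicate n .t) = 0 := by
  induction n with
  | zero => simp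
  | succ n ih => simp [List.replicate_succ, ih]

theorem transl_replicate_tInv (n : ℕ) : Letter.transl (List.replicate n .tInv) = 0 := by
  induction n with
  | zero => simp
  | succ n ih => simp [List.replicate_succ, ih]

/-- A word for the commutator of `tⁿ a t⁻ⁿ` and `t⁻¹ a t`. -/
def commWord (n : ℕ) : List Letter :=
  List.replicate n .t ++ (.a 1 :: (List.replicate n .tInv ++ (.tInv :: .a 1 :: .t ::
    (List.replicate n .t ++ (.a (-1) :: (List.replicate n .tInv ++ [.tInv, .a (-1), .t]))))))

theorem length_commWord (n : ℕ) : (commWord n).length = 4 * n + 8 := by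
  simp [commWord]; ring

theorem eval_commWord (n : ℕ) : eval (commWord n) = 1 := by
  apply eq_one_of_transl_height
  · rw [transl_eval]
    simp [commWord, height_replicate_t, height_replicate_tInv, transl_replicate_t,
      transl_replicate_tInv, zpow_neg]
    field_simp
    ring
  · rw [height_eval]
    simp [commWord, height_replicate_t, height_replicate_tInv]

theorem not_mem_upper_of_height_neg {g : BS12} (h : height g < 0) : g ∉ upper :=
  fun h' => absurd h'.1 (not_le.2 h)

theorem not_mem_upper_of_add_half {g : BS12} {z : ℤ} (h : transl g = z + 1 / 2) : g ∉ upper := by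
  rintro ⟨-, y, hy⟩
  rw [h] at hy
  have : ((2 * z + 1 : ℤ) : ℚ) = (2 * y : ℤ) := by push_cast; linarith
  have : 2 * z + 1 = 2 * y := by exact_mod_cast this
  omega

/-- Only the first letter `a` is traversed in `upper`, at height `n`. The second and fourth lie at
height -1, and the third starts at the non-integral translation part `2 ^ n + 1 / 2`. -/
theorem wordFlux_commWord (n : ℕ) : wordFlux 1 (commWord n) = 2 * 2 ^ n := by
  set u₁ : List Letter := List.replicate n .t with hu₁
  set u₂ : List Letter := List.replicate n .tInv with hu₂
  have H₁ : Letter.height u₁ = n := height_replicate_t n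
  have H₂ : Letter.height u₂ = -n := height_replicate_tInv n
  have X₁ : Letter.transl u₁ = 0 := transl_replicate_t n
  have X₂ : Letter.transl u₂ = 0 := transl_replicate_tInv n
  set w₂ : List Letter := u₁ ++ (.a 1 :: (u₂ ++ [.tInv])) with hw₂
  set w₃ : List Letter := w₂ ++ (.a 1 :: .t :: u₁) with hw₃
  set w₄ : List Letter := w₃ ++ (.a (-1) :: (u₂ ++ [.tInv])) with hw₄
  have h₁ : upperInd (eval u₁) = 1 := by
    have : eval u₁ ∈ upper := ⟨by simp [H₁], 0, by rw [transl_eval]; simp [X₁]⟩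
    simp [upperInd, this]
  have h₂ : upperInd (eval w₂) = 0 := by
    apply upperInd_of_not_mem
    apply not_mem_upper_of_height_neg
    rw [height_eval]
    simp [hw₂, H₁, H₂]
  have h₃ : upperInd (eval w₃) = 0 := by
    apply upperInd_of_not_mem
    apply not_mem_upper_of_add_half (z := 2 ^ n)
    rw [transl_eval]
    simp [hw₃, hw₂, H₁, H₂, X₁, X₂]
    field_simp
  have h₄ : upperInd (eval w₄) = 0 := by
    apply upperInd_of_not_mem
    apply not_mem_upper_of_height_neg
    rw [height_eval]
    simp [hw₄, hw₃, hw₂, H₁, H₂]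
  have hw : wordFlux 1 (commWord n) =
      flux (eval u₁) (eval u₁ * ofLetter (.a 1)) + flux (eval w₂) (eval w₂ * ofLetter (.a 1)) +
      flux (eval w₃) (eval w₃ * ofLetter (.a (-1))) +
      flux (eval w₄) (eval w₄ * ofLetter (.a (-1))) := by
    simp only [commWord, ← hu₁, ← hu₂, hw₄, hw₃, hw₂, wordFlux_append, wordFlux, eval_append,
      eval_cons, eval_nil, mul_one, one_mul, mul_assoc]
    simp only [hu₁, hu₂, wordFlux_replicate_t, wordFlux_replicate_tInv, ← mul_assoc]
    simp only [ofLetter, flux_genT, flux_genT_inv]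
    ring
  rw [hw, flux_ofLetter_a, flux_ofLetter_a, flux_ofLetter_a, flux_ofLetter_a, h₁, h₂, h₃, h₄,
    height_eval, H₁]
  simp

end BS12

end ShortcutGraph

/-! ### Geometric actions of BS(1,2) and the flux of walks -/

namespace ShortcutGraph

open BS12 SimpleGraph

variable {V : Type*} {Γ : SimpleGraph V}


theorem IsGeometricAction.eq_one_of_smul_eq {V : Type} {Γ : SimpleGraph V} [MulAction BS12 V]
    (h : IsGeometricAction BS12 Γ) {g : BS12} {v : V} (hg : g • v = v) : g = 1 := by
  have hfin : Finite (MulAction.stabilizer BS12 v) :=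
    ((h.proper {v}).subset fun g (hg : g • v = v) => ⟨v, by simp, by simp [hg]⟩).to_subtype
  apply eq_one_of_isOfFinOrder
  have := isOfFinOrder_of_finite (⟨g, hg⟩ : MulAction.stabilizer BS12 v)
  exact Submonoid.isOfFinOrder_coe.2 this

/-- As `BS(1,2)` is torsion-free, proper actions are free, and there is an equivariant map to
the group. -/
theorem IsGeometricAction.exists_equivariant {V : Type} {Γ : SimpleGraph V} [MulAction BS12 V]
    (h : IsGeometricAction BS12 Γ) : ∃ π : V → BS12, ∀ (g : BS12) (v : V), π (g • v) = g * π v := by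
  have hrep : ∀ v : V, ∃ g : BS12,
      g • (Quotient.mk (MulAction.orbitRel BS12 V) v).out = v := by
    intro v
    have : (MulAction.orbitRel BS12 V) v (Quotient.mk (MulAction.orbitRel BS12 V) v).out :=
      Setoid.symm' _ (Quotient.mk_out (s := MulAction.orbitRel BS12 V) v)
    exact MulAction.orbitRel_apply.1 this
  choose π hπ using hrep
  refine ⟨π, fun g v => ?_⟩
  have h1 : (Quotient.mk (MulAction.orbitRel BS12 V) (g • v)) =
      Quotient.mk (MulAction.orbitRel BS12 V) v :=
    Quotient.sound (s := MulAction.orbitRel BS12 V) (MulAction.orbitRel_apply.2 ⟨g, rfl⟩)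
  have h2 := hπ (g • v)
  rw [h1] at h2
  have h3 : (g * π v)⁻¹ * π (g • v) = 1 := h.eq_one_of_smul_eq
    (v := (Quotient.mk (MulAction.orbitRel BS12 V) v).out) (by
      rw [mul_smul, h2, mul_inv_rev, mul_smul, inv_smul_smul, inv_smul_eq_iff, hπ])
  exact (inv_mul_eq_one.1 h3).symm

theorem IsGeometricAction.finite_steps {V : Type} {Γ : SimpleGraph V} [MulAction BS12 V]
    (h : IsGeometricAction BS12 Γ) {π : V → BS12}
    (hπ : ∀ (g : BS12) (v : V), π (g • v) = g * π v) :
    {e | ∃ v w, Γ.Adj v w ∧ e = (π v)⁻¹ * π w}.Finite := by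
  obtain ⟨S, -, hS⟩ := h.cocompact
  refine ((S.finite_toSet.prod S.finite_toSet).image (fun p => (π p.1)⁻¹ * π p.2)).subset ?_
  rintro e ⟨v, w, hvw, rfl⟩
  obtain ⟨g, hv, hw⟩ := hS v w hvw
  exact ⟨(g • v, g • w), ⟨hv, hw⟩, by simp [hπ, mul_assoc]⟩


/-- The sum of the fluxes of the images in `BS(1,2)` of the edges of a walk. -/
noncomputable def walkFlux (π : V → BS12) : ∀ {v w : V}, Γ.Walk v w → ℝ
  | _, _, .nil => 0
  | v, _, .cons (v := u) _ p => flux (π v) (π u) + walkFlux π p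

variable (π : V → BS12)

@[simp] theorem walkFlux_nil (v : V) : walkFlux π (Walk.nil : Γ.Walk v v) = 0 := rfl

@[simp] theorem walkFlux_cons {u v w : V} (h : Γ.Adj v u) (p : Γ.Walk u w) :
    walkFlux π (Walk.cons h p) = flux (π v) (π u) + walkFlux π p := rfl

theorem walkFlux_append {u v w : V} (p : Γ.Walk u v) (q : Γ.Walk v w) :
    walkFlux π (p.append q) = walkFlux π p + walkFlux π q := by
  induction p with
  | nil => simp
  | cons h p ih => simp [ih, add_assoc]

theorem walkFlux_reverse {u v : V} (p : Γ.Walk u v) :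
    walkFlux π p.reverse = - walkFlux π p := by
  induction p with
  | nil => simp
  | @cons a b c h p ih =>
    rw [Walk.reverse_cons, walkFlux_append, ih, walkFlux_cons, walkFlux_cons, walkFlux_nil,
      flux_comm (π a) (π b)]
    ring

theorem walkFlux_copy {u v u' v' : V} (p : Γ.Walk u v) (hu : u = u') (hv : v = v') :
    walkFlux π (p.copy hu hv) = walkFlux π p := by
  subst hu hv; rfl

theorem exists_walk_split {u v : V} (p : Γ.Walk u v) (i : ℕ) (hi : i ≤ p.length) :
    ∃ (x : V) (q : Γ.Walk u x) (r : Γ.Walk x v), x = p.getVert i ∧ q.length = i ∧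
      r.length + i = p.length ∧ (∀ k, r.getVert k = p.getVert (i + k)) ∧
      walkFlux π p = walkFlux π q + walkFlux π r := by
  induction p generalizing i with
  | @nil u =>
    obtain rfl : i = 0 := by simpa using hi
    exact ⟨u, .nil, .nil, rfl, rfl, rfl, fun k => by simp, by simp⟩
  | @cons u v w h p ih =>
    rcases i with - | i
    · exact ⟨u, .nil, .cons h p, rfl, rfl, rfl, fun k => by simp, by simp⟩
    · obtain ⟨x, q, r, h0, h1, h2, h3, h4⟩ := ih i (by simpa using hi)
      refine ⟨x, .cons h q, r, by simpa using h0, by simp [h1], by simp; omega, fun k => ?_,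
        by simp [h4, add_assoc]⟩
      rw [h3, show i + 1 + k = (i + k) + 1 by ring, Walk.getVert_cons_succ]

theorem finite_walk_steps
    (hπ : {e | ∃ v w, Γ.Adj v w ∧ e = (π v)⁻¹ * π w}.Finite) (L : ℕ) :
    {e | ∃ (v w : V) (p : Γ.Walk v w), p.length = L ∧ e = (π v)⁻¹ * π w}.Finite := by
  induction L with
  | zero =>
    refine (Set.finite_singleton (1 : BS12)).subset ?_
    rintro _ ⟨v, w, p, hp, rfl⟩
    cases Walk.eq_of_length_eq_zero hp
    simp
  | succ L ih =>
    refine ((hπ.prod ih).image (fun p => p.1 * p.2)).subset ?_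
    rintro _ ⟨v, w, p, hp, rfl⟩
    cases p with
    | nil => simp at hp
    | @cons _ u _ h p =>
      exact ⟨((π v)⁻¹ * π u, (π u)⁻¹ * π w), ⟨⟨v, u, h, rfl⟩, ⟨u, w, p, by simpa using hp, rfl⟩⟩,
        by simp [mul_assoc]⟩

/-- The walk is coned off from its starting point into triangles, which have finitely many shapes up
to translation. -/
theorem exists_walkFlux_sub_flux_le
    (hπ : {e | ∃ v w, Γ.Adj v w ∧ e = (π v)⁻¹ * π w}.Finite) (L : ℕ) :
    ∃ C, 0 ≤ C ∧ ∀ (v w : V) (p : Γ.Walk v w), p.length ≤ L →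
      |walkFlux π p - flux (π v) (π w)| ≤ C := by
  induction L with
  | zero =>
    refine ⟨0, le_rfl, fun v w p hp => ?_⟩
    cases p with
    | nil => simp [flux_self]
    | cons h p => simp at hp
  | succ L ih =>
    obtain ⟨C, hC0, hC⟩ := ih
    obtain ⟨D, hD⟩ := exists_flux_triangle_le_of_finite hπ (finite_walk_steps π hπ (L + 1))
    refine ⟨C + |D|, by positivity, fun v w p hp => ?_⟩
    rcases hp.lt_or_eq with hp | hp
    · exact (hC v w p (by omega)).trans (by linarith [abs_nonneg D])
    cases p with
    | nil => simp at hp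
    | @cons _ u _ h p =>
      have h1 := hC u w p (by simp at hp; omega)
      have h2 := hD (π v) (π u) (π w) ⟨v, u, h, rfl⟩ ⟨v, w, .cons h p, hp, rfl⟩
      rw [walkFlux_cons]
      calc _ = |(walkFlux π p - flux (π u) (π w)) +
            (flux (π v) (π u) + flux (π u) (π w) - flux (π v) (π w))| := by congr 1; ring
        _ ≤ _ := (abs_add_le _ _).trans (by linarith [le_abs_self D])

/-! ### Splitting closed walks in strongly shortcut graphs -/

theorem EdgePoint.dist_src_le (hΓ : Γ.Connected) (p q : EdgePoint Γ) :
    (Γ.dist p.src q.src : ℝ) ≤ p.dist q + 2 := by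
  have hp := p.pos_mem
  have hq := q.pos_mem
  have ap : Γ.dist p.src p.tgt = 1 := SimpleGraph.dist_eq_one_iff_adj.2 p.adj
  have aq : Γ.dist q.tgt q.src = 1 := SimpleGraph.dist_eq_one_iff_adj.2 q.adj.symm
  have t1 : (Γ.dist p.src q.src : ℝ) ≤ Γ.dist p.src q.tgt + 1 := by
    exact_mod_cast aq ▸ hΓ.dist_triangle (u := p.src) (v := q.tgt) (w := q.src)
  have t2 : (Γ.dist p.src q.src : ℝ) ≤ 1 + Γ.dist p.tgt q.src := by
    exact_mod_cast ap ▸ hΓ.dist_triangle (u := p.src) (v := p.tgt) (w := q.src)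
  have t3 : (Γ.dist p.tgt q.src : ℝ) ≤ Γ.dist p.tgt q.tgt + 1 := by
    exact_mod_cast aq ▸ hΓ.dist_triangle (u := p.tgt) (v := q.tgt) (w := q.src)
  unfold EdgePoint.dist
  split_ifs with h1 h2
  · rw [h1.1, SimpleGraph.dist_self]
    push_cast
    positivity
  · rw [h2.1, aq]
    push_cast
    linarith [abs_nonneg (p.pos - (1 - q.pos))]
  · unfold EdgePoint.distVia
    rw [← sub_le_iff_le_add, le_min_iff, le_min_iff, le_min_iff]
    refine ⟨⟨?_, ?_⟩, ⟨?_, ?_⟩⟩ <;> linarith [hp.1, hp.2, hq.1, hq.2]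

/-- The cycle traversed by a closed walk. -/
def cycleOfWalk {v : V} (w : Γ.Walk v v) (hw : 0 < w.length) : CycleIn Γ w.length where
  vert i := w.getVert i.val
  length_pos := hw
  adj i := by
    have : NeZero w.length := ⟨hw.ne'⟩
    have hlt := ZMod.val_lt i
    have h := w.adj_getVert_succ hlt
    convert h using 1
    rw [ZMod.val_add, ZMod.val_one_eq_one_mod, Nat.add_mod_mod]
    rcases (Nat.succ_le_of_lt hlt).lt_or_eq with h' | h'
    · rw [Nat.mod_eq_of_lt h']
    -- The closing edge: the walk ends at its starting vertex.
    · have h'' : i.val + 1 = w.length := h'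
      rw [h'']
      simp

theorem exists_dist_lt_of_not_isAlmostIsometric (hΓ : Γ.Connected) {v : V} (w : Γ.Walk v v)
    (hw : 0 < w.length) {ξ : ℝ} (h : ¬ (cycleOfWalk w hw).IsAlmostIsometric ξ) :
    ∃ i j, i ≤ j ∧ j ≤ w.length ∧ w.length ≤ 2 * (j - i) + 1 ∧ 2 * (j - i) ≤ w.length + 1 ∧
      (Γ.dist (w.getVert i) (w.getVert j) : ℝ) ≤ ξ * (w.length / 2) + 2 := by
  have : NeZero w.length := ⟨hw.ne'⟩
  unfold CycleIn.IsAlmostIsometric at h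
  push Not at h
  obtain ⟨x, hx⟩ := h
  have h1 := EdgePoint.dist_src_le hΓ ((cycleOfWalk w hw).point x)
    ((cycleOfWalk w hw).point (x + w.length / 2))
  set a := ⌊x⌋ with ha
  set b := ⌊x + (w.length : ℝ) / 2⌋ with hb
  have ha1 := Int.floor_le x
  have ha2 := Int.lt_floor_add_one x
  have hb1 := Int.floor_le (x + (w.length : ℝ) / 2)
  have hb2 := Int.lt_floor_add_one (x + (w.length : ℝ) / 2)
  rw [← ha] at ha1 ha2
  rw [← hb] at hb1 hb2
  have c1 : (w.length : ℤ) < 2 * (b - a) + 2 := by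
    have : (w.length : ℝ) < 2 * (b - a) + 2 := by linarith
    exact_mod_cast this
  have c2 : 2 * (b - a) < (w.length : ℤ) + 2 := by
    have : (2 * (b - a) : ℝ) < w.length + 2 := by linarith
    exact_mod_cast this
  set i := (a : ZMod w.length).val with hi
  set j := (b : ZMod w.length).val with hj
  have hi1 : (i : ℤ) = a % w.length := ZMod.val_intCast a
  have hj1 : (j : ℤ) = b % w.length := ZMod.val_intCast b
  have hil : i < w.length := ZMod.val_lt _
  have hjl : j < w.length := ZMod.val_lt _
  have hd : (Γ.dist (w.getVert i) (w.getVert j) : ℝ) ≤ ξ * (w.length / 2) + 2 := by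
    have h2 : (Γ.dist (w.getVert i) (w.getVert j) : ℝ) ≤ _ := h1
    linarith
  have ea := Int.emod_add_mul_ediv a w.length
  have eb := Int.emod_add_mul_ediv b w.length
  -- `d` counts the passages through the base vertex between the two antipodal points; if there is
  -- one, the indices change roles.
  obtain ⟨d, hdd⟩ : ∃ d : ℤ, d = b / w.length - a / w.length := ⟨_, rfl⟩
  have hji : (j : ℤ) - i = (b - a) - w.length * d := by
    rw [hi1, hj1, hdd, mul_sub]; linarith
  have hd0 : d = 0 ∨ d = 1 := by
    have u1 : d < 2 := by
      by_contra! hc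
      nlinarith
    have u2 : -1 < d := by
      by_contra! hc
      nlinarith
    omega
  rcases hd0 with rfl | rfl
  · exact ⟨i, j, by omega, by omega, by omega, by omega, hd⟩
  · refine ⟨j, i, by omega, by omega, by omega, by omega, by rwa [SimpleGraph.dist_comm]⟩

/-- In a strongly shortcut graph, long closed walks split in two that are shorter by a definite
factor. -/
theorem IsStronglyShortcut.exists_split (h : IsStronglyShortcut Γ) :
    ∃ (N : ℕ) (r : ℝ), 0 < r ∧ r < 1 ∧ ∀ (v : V) (w : Γ.Walk v v), N < w.length →
      ∃ (u : V) (w₁ : Γ.Walk u u) (w₂ : Γ.Walk v v), (w₁.length : ℝ) ≤ r * w.length ∧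
        (w₂.length : ℝ) ≤ r * w.length ∧ walkFlux π w = walkFlux π w₁ + walkFlux π w₂ := by
  obtain ⟨hΓ, θ, ξ, h0, h1, hθ⟩ := h
  obtain ⟨N, hN⟩ := exists_nat_ge (10 / (1 - ξ))
  -- Each piece has length at most `(1 + ξ) / 2 * n + 5 / 2`. The ratio is the midpoint of `(1 + ξ)
  -- / 2` and 1, and the excess `5 / 2` is absorbed once `(1 - ξ) * n ≥ 10`.
  refine ⟨max θ N, (3 + ξ) / 4, by linarith, by linarith, fun v w hw => ?_⟩
  rw [max_lt_iff] at hw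
  have hpos : 0 < w.length := by omega
  obtain ⟨i, j, hij, hj, l1, l2, hd⟩ := exists_dist_lt_of_not_isAlmostIsometric hΓ w hpos
    (ξ := ξ) (fun hc => absurd (hθ _ _ hc) (by omega))
  have hlen : 10 ≤ (1 - ξ) * w.length := by
    rw [div_le_iff₀ (by linarith)] at hN
    have : (N : ℝ) ≤ w.length := by exact_mod_cast hw.2.le
    nlinarith
  obtain ⟨x, p, q, hx, hp, hq, hqv, hf⟩ := exists_walk_split π w i (by omega)
  obtain ⟨y, m, s, hy, hm, hs, -, hf'⟩ := exists_walk_split π q (j - i) (by omega)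
  rw [hqv, Nat.add_sub_cancel' hij] at hy
  rw [← hx, ← hy] at hd
  obtain ⟨e, he⟩ := hΓ.exists_walk_length_eq_dist x y
  have l1' : (w.length : ℝ) ≤ 2 * m.length + 1 := by rw [hm]; exact_mod_cast l1
  have l2' : (2 * m.length : ℝ) ≤ w.length + 1 := by rw [hm]; exact_mod_cast l2
  have l3 : (p.length : ℝ) + m.length + s.length = w.length := by
    exact_mod_cast (by omega : p.length + m.length + s.length = w.length)
  have he' : (e.length : ℝ) ≤ ξ * (w.length / 2) + 2 := by rw [he]; exact hd
  refine ⟨x, m.append e.reverse, (p.append e).append s, ?_, ?_, ?_⟩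
  · rw [Walk.length_append, Walk.length_reverse]
    push_cast
    linarith
  · rw [Walk.length_append, Walk.length_append]
    push_cast
    linarith
  -- The connecting geodesic `e` is traversed once in each direction, so its flux cancels.
  · rw [hf, hf', walkFlux_append, walkFlux_append, walkFlux_append, walkFlux_reverse]
    ring

theorem IsStronglyShortcut.exists_walkFlux_le (h : IsStronglyShortcut Γ)
    (hπ : {e | ∃ v w, Γ.Adj v w ∧ e = (π v)⁻¹ * π w}.Finite) :
    ∃ (K : ℝ) (d : ℕ), 0 ≤ K ∧ ∀ (v : V) (w : Γ.Walk v v),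
      |walkFlux π w| ≤ K * (w.length : ℝ) ^ d := by
  obtain ⟨N, r, hr0, hr1, hsplit⟩ := h.exists_split π
  obtain ⟨C, hC0, hC⟩ := exists_walkFlux_sub_flux_le π hπ N
  -- With `2 * r ^ d < 1`, the bounds for the two pieces add up to at most the bound for the whole.
  obtain ⟨d, hd⟩ := exists_pow_lt_of_lt_one (show (0 : ℝ) < 1 / 2 by norm_num) hr1
  refine ⟨C, d, hC0, ?_⟩
  suffices H : ∀ (n : ℕ) (v : V) (w : Γ.Walk v v), w.length = n →
      |walkFlux π w| ≤ C * (w.length : ℝ) ^ d from fun v w => H _ v w rfl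
  intro n
  induction n using Nat.strong_induction_on with
  | _ n ih =>
    intro v w hn
    rcases Nat.eq_zero_or_pos w.length with h0 | h0
    · cases w with
      | nil => simp; positivity
      | cons h p => simp at h0
    rcases le_or_gt w.length N with hN | hN
    · have h1 := hC v v w hN
      rw [flux_self, sub_zero] at h1
      have : (1 : ℝ) ≤ (w.length : ℝ) ^ d := one_le_pow₀ (by exact_mod_cast h0)
      nlinarith
    · obtain ⟨u, w₁, w₂, h1, h2, hf⟩ := hsplit v w hN
      have h0' : (0 : ℝ) < w.length := by exact_mod_cast h0
      have hlt : r * w.length < w.length := by nlinarith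
      have b1 := ih w₁.length (by
        rw [← hn]; exact_mod_cast h1.trans_lt hlt) u w₁ rfl
      have b2 := ih w₂.length (by
        rw [← hn]; exact_mod_cast h2.trans_lt hlt) v w₂ rfl
      have p1 : (w₁.length : ℝ) ^ d ≤ r ^ d * (w.length : ℝ) ^ d := by
        rw [← mul_pow]; gcongr
      have p2 : (w₂.length : ℝ) ^ d ≤ r ^ d * (w.length : ℝ) ^ d := by
        rw [← mul_pow]; gcongr
      have p3 : r ^ d * (w.length : ℝ) ^ d ≤ 1 / 2 * (w.length : ℝ) ^ d := by gcongr
      rw [hf]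
      calc _ ≤ C * (w₁.length : ℝ) ^ d + C * (w₂.length : ℝ) ^ d :=
            (abs_add_le _ _).trans (add_le_add b1 b2)
        _ ≤ C * (1 / 2 * (w.length : ℝ) ^ d) + C * (1 / 2 * (w.length : ℝ) ^ d) := by
            gcongr
            · exact p1.trans p3
            · exact p2.trans p3
        _ = _ := by ring

/-! ### Exponential flux against polynomial growth -/

/-- Words label walks between the vertices of an orbit, with almost the same flux. -/
theorem exists_walk_of_word {V : Type} {Γ : SimpleGraph V} [MulAction BS12 V]
    (h : IsGeometricAction BS12 Γ) (hΓ : Γ.Connected) {π : V → BS12}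
    (hπ : ∀ (g : BS12) (v : V), π (g • v) = g * π v) {v : V} (hv : π v = 1) :
    ∃ (L : ℕ) (C : ℝ), 0 ≤ C ∧ ∀ (w : List Letter) (g : BS12),
      ∃ p : Γ.Walk (g • v) ((g * eval w) • v), p.length ≤ L * w.length ∧
        |walkFlux π p - wordFlux g w| ≤ C * w.length := by
  obtain ⟨L, hL⟩ : ∃ L, ∀ x, Γ.dist v (ofLetter x • v) ≤ L := by
    refine ⟨Γ.dist v (ofLetter (.a 1) • v) + Γ.dist v (ofLetter (.a (-1)) • v) +
      Γ.dist v (ofLetter .t • v) + Γ.dist v (ofLetter .tInv • v), fun x => ?_⟩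
    rcases x with s | - | -
    · rcases Int.units_eq_one_or s with rfl | rfl <;> omega
    · omega
    · omega
  obtain ⟨C, hC0, hC⟩ := exists_walkFlux_sub_flux_le π (h.finite_steps hπ) L
  refine ⟨L, C, hC0, fun w => ?_⟩
  induction w with
  | nil => exact fun g => ⟨Walk.nil.copy rfl (by simp), by rw [Walk.length_copy]; simp,
      by rw [walkFlux_copy]; simp [wordFlux]⟩
  | cons x w ih =>
    intro g
    obtain ⟨p, hp, hpf⟩ := ih (g * ofLetter x)
    obtain ⟨q₀, hq₀⟩ := hΓ.exists_walk_length_eq_dist v (ofLetter x • v)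
    let φ : Γ →g Γ := ⟨fun u => g • u, fun {a b} hab => h.adj_smul g a b hab⟩
    let q : Γ.Walk (g • v) ((g * ofLetter x) • v) := (q₀.map φ).copy rfl (mul_smul g _ v).symm
    have hq : q.length ≤ L := by
      simp only [q, Walk.length_copy, Walk.length_map, hq₀, hL]
    have hqf := hC _ _ q hq
    rw [hπ, hπ, hv, mul_one, mul_one] at hqf
    refine ⟨(q.append p).copy rfl (by simp [mul_assoc]), ?_, ?_⟩
    · rw [Walk.length_copy, Walk.length_append, List.length_cons, mul_add]
      omega
    · rw [walkFlux_copy, walkFlux_append, wordFlux, add_sub_add_comm, List.length_cons]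
      refine (abs_add_le _ _).trans ?_
      push_cast
      linarith

theorem not_isStronglyShortcutGroup_BS12 : ¬ IsStronglyShortcutGroup BS12 := by
  rintro ⟨V, Γ, inst, hss, h⟩
  obtain ⟨π, hπ⟩ := h.exists_equivariant
  obtain ⟨K, d, hK, hflux⟩ := hss.exists_walkFlux_le π (h.finite_steps hπ)
  obtain ⟨v₀⟩ := hss.1.nonempty
  -- The base point is translated so that `π` sends it to 1.
  obtain ⟨L, C, hC, hword⟩ := exists_walk_of_word h hss.1 hπ (v := (π v₀)⁻¹ • v₀) (by simp [hπ])
  have key : ∀ n : ℕ, 1 ≤ n →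
      (2 : ℝ) ^ n ≤ (C + K * L ^ d) * 12 ^ (d + 1) * (n : ℝ) ^ (d + 1) := by
    intro n hn
    obtain ⟨p, hp, hpf⟩ := hword (commWord n) 1
    have h1 := hflux _ (p.copy rfl (by rw [eval_commWord, mul_one]))
    rw [walkFlux_copy, Walk.length_copy] at h1
    rw [wordFlux_commWord] at hpf
    -- `4 * n + 8 ≤ 12 * n` because `n ≥ 1`.
    have hl : ((commWord n).length : ℝ) ≤ 12 * n := by
      rw [length_commWord]
      exact_mod_cast (by omega : 4 * n + 8 ≤ 12 * n)
    have hp' : (p.length : ℝ) ≤ L * (12 * n) := by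
      have : (p.length : ℝ) ≤ L * (commWord n).length := by exact_mod_cast hp
      exact this.trans (by gcongr)
    have hn' : (1 : ℝ) ≤ 12 * n := by
      have : (1 : ℝ) ≤ n := by exact_mod_cast hn
      linarith
    have h2 : (2 : ℝ) * 2 ^ n ≤ C * (12 * n) + K * (L * (12 * n)) ^ d := by
      calc (2 : ℝ) * 2 ^ n ≤ |walkFlux π p - 2 * 2 ^ n| + |walkFlux π p| := by
            rw [abs_sub_comm]
            linarith [le_abs_self (2 * 2 ^ n - walkFlux π p), le_abs_self (walkFlux π p)]
        _ ≤ C * (commWord n).length + K * (p.length : ℝ) ^ d := add_le_add hpf h1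
        _ ≤ _ := by gcongr
    have h3 : (12 * n : ℝ) ≤ (12 * n) ^ (d + 1) := le_self_pow₀ hn' (by omega)
    have h4 : (12 * n : ℝ) ^ d ≤ (12 * n) ^ (d + 1) := pow_le_pow_right₀ hn' (by omega)
    calc (2 : ℝ) ^ n ≤ 2 * 2 ^ n := by linarith [pow_pos (two_pos : (0 : ℝ) < 2) n]
      _ ≤ C * (12 * n) + K * (L * (12 * n)) ^ d := h2
      _ ≤ C * (12 * n) ^ (d + 1) + K * (L ^ d * (12 * n) ^ (d + 1)) := by
          rw [mul_pow]; gcongr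
      _ = _ := by rw [mul_pow]; ring
  have hlim := (tendsto_pow_const_div_const_pow_of_one_lt (d + 1) (one_lt_two (α := ℝ))).const_mul
    ((C + K * L ^ d) * 12 ^ (d + 1))
  rw [mul_zero] at hlim
  obtain ⟨n, hn1, hn2⟩ := ((hlim.eventually_lt_const one_pos).and
    (Filter.eventually_ge_atTop 1)).exists
  have := key n hn2
  rw [← mul_div_assoc, div_lt_one (by positivity)] at hn1
  linarith

end ShortcutGraph

theorem mainTheorem9 :
    (∀ (n : ℕ) (f : ShortcutGraph.CycleIn ShortcutGraph.bsCayley n), f.IsIsometric → n ≤ 5) ∧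
    ShortcutGraph.IsShortcut ShortcutGraph.bsCayley ∧
    ShortcutGraph.IsShortcutGroup ShortcutGraph.BS12 ∧
    ¬ ShortcutGraph.IsStronglyShortcutGroup ShortcutGraph.BS12 :=
  ⟨fun _ _ hf => hf.length_le_five, ShortcutGraph.isShortcut_bsCayley,
    ShortcutGraph.isShortcutGroup_BS12, ShortcutGraph.not_isStronglyShortcutGroup_BS12⟩
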